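/- Let $F$ be the free group on $X=\{x_1,\dots,x_k\}$, let $A=(a_1,\dots,a_m)$ be a finite tuple of elements of $F$, and let $R$ be the normal closure of $A$ in $F$. Write $[a,b]=a^{-1}b^{-1}ab$, $\gamma_1F=F$ and $\gamma_{n+1}F=[\gamma_nF,F]$. **Basic commutators.** The basic commutators of weight $1$ are the elements of $X$. A basic commutator of weight $w\ge 2$ is a (formal) commutator $[b,c]$ of basic commutators $b>c$ whose weights add up to $w$, such that $e\le c$ whenever $b=[d,e]$. Here commutators are ordered by any fixed strict total order in which smaller weight comes first. **Nielsen transformations.** A Nielsen transformation of a finite tuple is a finite sequence of the following steps: exchange two entries; replace an entry $a_i$ by $a_i^{-1}$; replace an entry $a_i$ by $a_ia_j$ with $j\ne i$. **$R$-basic commutators.** For $w=1,2,3,\dots$ one constructs tuples $x_w=(x_{w,1},\dots,x_{w,N_w})$ and $y_w=(y_{w,1},\dots,y_{w,m_w})$ in $F$, an integer $0\le s_w\le\min(N_w,m_w)$ and positive integers $d_{w,1}\mid d_{w,2}\mid\cdots\mid d_{w,s_w}$ as follows. 1. The starting tuple $A_w$: put $A_1=A$. For $w\ge2$, $A_w$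 consists of the left-over entries $y_{w-1,i}$ with $i>s_{w-1}$, together with all commutators formed from an entry $y_{p,i}$ with $i\le s_p$ and an entry $x_{q,j}$, where $p,q\ge1$ and $p+q=w$. Such a commutator is written as $[y_{p,i},x_{q,j}]$ if $p>q$, or if $p=q$ and $i\ge j$; otherwise it is written as $[x_{q,j},y_{p,i}]$. 2. Choose $y_w$ obtained from $A_w$ by a Nielsen transformation, and $x_w$ obtained by a Nielsen transformation from a list, without repetition, of all basic commutators of weight $w$, such that $$y_{w,i}\equiv x_{w,i}^{d_{w,i}}\pmod{\gamma_{w+1}F}\quad(1\le i\le s_w),\qquad y_{w,i}\equiv1\pmod{\gamma_{w+1}F}\quad(s_w<i\le m_w).$$ The elements $y_{w,1},\dots,y_{w,s_w}$ are called the $R$-basic commutators of weight $w$. **Theorem.** The construction can be carried out for all weights $w\ge1$. Moreover, let $n\ge0$, let the construction be carried out up to weight $n$ in any way, and let $r_1<r_2<\dots<r_t$ be the resulting $R$-basic commutators of weights $\le n$, listed in any chosen order. Then for every $g\in R$ there is exactly one tuple of integers $(\alpha_1,\dots,\alpha_t)$ such that $$g\equiv r_1^{\alpha_1}r_2^{\alpha_2}\cdots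 r_t^{\alpha_t}\pmod{R\cap\gamma_{n+1}F}.$$ -/

import Mathlib

namespace RelBasic

section Group

variable {G : Type*} [Group G]

/-- The group commutator `[a, b] = a⁻¹ b⁻¹ a b`. -/
def gcomm (a b : G) : G := a⁻¹ * b⁻¹ * a * b

/-- The lower central series numbered from one: `lcs G 1 = G` and
`lcs G (n + 1) = [lcs G n, G]` for `n ≥ 1`. (The value at `0` is `G` and is never used.) -/
def lcs (G : Type*) [Group G] (n : ℕ) : Subgroup G :=
  (⊤ : Subgroup G).lowerCentralSeries (n - 1)

/-- The elementary Nielsen transformations of a finite tuple of group elements. -/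
inductive NielsenStep : List G → List G → Prop
  /-- exchange two entries -/
  | swap (l : List G) (i j : Fin l.length) : NielsenStep l ((l.set i l[j]).set j l[i])
  /-- replace an entry by its inverse -/
  | inv (l : List G) (i : Fin l.length) : NielsenStep l (l.set i (l[i])⁻¹)
  /-- replace an entry by its product with another entry -/
  | mul (l : List G) (i j : Fin l.length) (h : i ≠ j) : NielsenStep l (l.set i (l[i] * l[j]))

/-- A Nielsen transformation: finitely many elementary ones, performed one after another. -/
def Nielsen (l l' : List G) : Prop := Relation.ReflTransGen NielsenStep l l'

end Group

/-- An ordering of the formal (bracketed) commutators in the letters `Fin k` that is suitable for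
defining basic commutators: a strict total order in which smaller weight comes first. The weight
of a formal commutator is its number of letters, `FreeMagma.length`. -/
structure IsCommutatorOrder {k : ℕ} (lt : FreeMagma (Fin k) → FreeMagma (Fin k) → Prop) :
    Prop where
  total : IsStrictTotalOrder (FreeMagma (Fin k)) lt
  weight : ∀ a b : FreeMagma (Fin k), a.length < b.length → lt a b

/-- Basic commutators, as formal commutators: every letter is basic, and `[b, c]` is basic if
`b` and `c` are basic, `b > c`, and `e ≤ c` whenever `b = [d, e]`. -/
def IsBasic {k : ℕ} (lt : FreeMagma (Fin k) → FreeMagma (Fin k) → Prop) :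
    FreeMagma (Fin k) → Prop
  | .of _ => True
  | .mul b c => IsBasic lt b ∧ IsBasic lt c ∧ lt c b ∧
      ∀ d e : FreeMagma (Fin k), b = .mul d e → e = c ∨ lt e c

/-- The element of the free group denoted by a formal commutator. -/
def eval {k : ℕ} : FreeMagma (Fin k) → FreeGroup (Fin k)
  | .of i => FreeGroup.of i
  | .mul b c => gcomm (eval b) (eval c)

/-- `B` lists the basic commutators of weight `w` as elements of the free group. -/
def IsBasicList {k : ℕ} (lt : FreeMagma (Fin k) → FreeMagma (Fin k) → Prop) (w : ℕ)
    (B : List (FreeGroup (Fin k))) : Prop :=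
  ∃ T : List (FreeMagma (Fin k)), T.Nodup ∧
    (∀ t, t ∈ T ↔ IsBasic lt t ∧ t.length = w) ∧ B = T.map eval

/-! In the construction, `x w` is the list of free generators chosen for weight `w`, `y w` the
list of generators of the subgroup `H_w` chosen for weight `w`, and `s w` the number of those
entries of `y w` that are non-trivial modulo the next term of the lower central series. -/

section Construction

variable {k : ℕ} (rel : List (FreeGroup (Fin k))) (x y : ℕ → List (FreeGroup (Fin k)))
  (s : ℕ → ℕ)

/-- The `R`-basic commutators of weight `w`: the first `s w` entries of `y w`. -/
def rBasic (w : ℕ) : List (FreeGroup (Fin k)) := (y w).take (s w)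

/-- The commutators of the `R`-basic commutators of weight `p` with the free generators of
weight `q`. The larger entry stands first: entries are compared by weight and then by index. -/
def crossComm (p q : ℕ) : List (FreeGroup (Fin k)) :=
  (rBasic y s p).zipIdx.flatMap fun a => (x q).zipIdx.map fun b =>
    if q < p ∨ (q = p ∧ b.2 ≤ a.2) then gcomm a.1 b.1 else gcomm b.1 a.1

/-- The generators of `H_w` from which the step of weight `w` starts. For `w = 1` these are the
relators; for `w = n + 2` they are the left-over generators of weight `n + 1` together with all
commutators of an `R`-basic commutator of weight `p` with a free generator of weight `q`, where
`p, q ≥ 1` and `p + q = n + 2`. -/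
def stageGens : ℕ → List (FreeGroup (Fin k))
  | 0 => []
  | 1 => rel
  | n + 2 => (y (n + 1)).drop (s (n + 1)) ++
      (List.Nat.antidiagonal n).flatMap fun pq => crossComm x y s (pq.1 + 1) (pq.2 + 1)

/-- The `R`-basic commutators of weight at most `n`, by increasing weight. -/
def rBasicsUpTo (n : ℕ) : List (FreeGroup (Fin k)) :=
  (List.range' 1 n).flatMap fun w => rBasic y s w

/-- The step of weight `w` has been carried out correctly: Nielsen transformations lead from the
generators of `H_w` to `y w` and from the basic commutators of weight `w` to `x w`, and modulo
`lcs (w + 1)` the tuple `y w` is in diagonal form with respect to `x w`, with positive diagonal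
entries `d w 0 ∣ d w 1 ∣ ⋯`. -/
structure IsStage (lt : FreeMagma (Fin k) → FreeMagma (Fin k) → Prop) (d : ℕ → ℕ → ℕ)
    (w : ℕ) : Prop where
  nielsen_x : ∃ B, IsBasicList lt w B ∧ Nielsen B (x w)
  nielsen_y : Nielsen (stageGens rel x y s w) (y w)
  s_le_x : s w ≤ (x w).length
  s_le_y : s w ≤ (y w).length
  d_pos : ∀ j, j < s w → 0 < d w j
  d_dvd : ∀ j, j + 1 < s w → d w j ∣ d w (j + 1)
  diag : ∀ (j : ℕ) (hy : j < (y w).length) (hx : j < (x w).length), j < s w →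
    ((x w)[j] ^ d w j)⁻¹ * (y w)[j] ∈ lcs (FreeGroup (Fin k)) (w + 1)
  rest : ∀ (j : ℕ) (hy : j < (y w).length), s w ≤ j →
    (y w)[j] ∈ lcs (FreeGroup (Fin k)) (w + 1)

end Construction

end RelBasic

/-! Two facts about the free group `F` carry the proof. The basic commutators of weight `w` generate
`lcs w` modulo `lcs (w + 1)` (`lcs_le_basicSpan`, a collection argument resting on the Hall–Witt
identity). They are also independent there: under the Magnus map `x_i ↦ 1 + x_i X` the coefficient
of `X ^ w`, called `lead w`, is additive on `lcs w`, kills `lcs (w + 1)` and sends a formal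
commutator of weight `w` to its Lie polynomial. Lazard elimination shows that the Lie polynomials of
basic commutators are linearly independent (`linearIndependent_liePoly`). So the basic commutators,
and every Nielsen transform `x w` of them, form a basis of `lcs w` modulo `lcs (w + 1)`.

One step of the construction is then the Smith normal form of the integer matrix that expresses the
starting tuple in such a basis; row and column operations are realised by Nielsen transformations
(`exists_diagonal`).

For the exponents, let `K_w` (`relFil`) be the normal closure of the starting tuple of weight `w`
together with all `[a, c]`, where `a` is an `R`-basic commutator of weight `p < w`, `c ∈ lcs q` and
`p + q ≥ w`. Then `K_1 = R`, `K_w ≤ R ⊓ lcs w`, and the `R`-basic commutators of weight `w` are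
central modulo `K_(w+1)` and generate `K_w` modulo it (`relFil_le_sup`). Exponents are therefore
found weight by weight, and centrality allows each correction to be absorbed in place, whatever the
order of the factors. They are unique because the leads of the `R`-basic commutators of weight `w`
are nonzero multiples of distinct basis vectors, hence independent over `ℤ`. -/

namespace RelBasic

open scoped commutatorElement PowerSeries

/-! ### Commutators modulo a normal subgroup. -/

section Commutators

variable {G : Type*} [Group G]

theorem gcomm_eq (a b : G) : gcomm a b = ⁅a⁻¹, b⁻¹⁆ := by
  simp [gcomm, commutatorElement_def]

theorem gcomm_eq_one_iff {a b : G} : gcomm a b = 1 ↔ Commute a b := by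
  rw [gcomm_eq, commutatorElement_eq_one_iff_commute, Commute.inv_inv_iff]

theorem gcomm_inv (a b : G) : (gcomm a b)⁻¹ = gcomm b a := by
  simp [gcomm, mul_assoc]

theorem map_gcomm {H : Type*} [Group H] (f : G →* H) (a b : G) :
    f (gcomm a b) = gcomm (f a) (f b) := by
  simp [gcomm]

/-- The Hall–Witt identity. -/
theorem hall_witt (x y z : G) :
    (y⁻¹ * gcomm (gcomm x y⁻¹) z * y) * (z⁻¹ * gcomm (gcomm y z⁻¹) x * z) *
      (x⁻¹ * gcomm (gcomm z x⁻¹) y * x) = 1 := by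
  simp only [gcomm]
  group

/-- In the Hall–Witt identity for `d, e⁻¹, c` the two hypotheses kill the second and third factors,
and what remains is a conjugate of `gcomm (gcomm d e) c`. This is the three subgroups lemma for
single elements. -/
theorem commute_gcomm_of_rotate {d e c : G} (h₁ : Commute (gcomm e⁻¹ c⁻¹) d)
    (h₂ : Commute (gcomm c d⁻¹) e) : Commute (gcomm d e) c := by
  have h := hall_witt d e⁻¹ c
  rw [gcomm_eq_one_iff.2 h₁, gcomm_eq_one_iff.2 h₂.inv_right, inv_inv] at h
  rw [← gcomm_eq_one_iff]
  simpa using h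

/-- The elements commuting with `c` modulo a normal subgroup. -/
def centMod (N : Subgroup G) [N.Normal] (c : G) : Subgroup G :=
  (Subgroup.centralizer {QuotientGroup.mk' N c}).comap (QuotientGroup.mk' N)

variable {N : Subgroup G} [N.Normal]

theorem mem_centMod {u c : G} :
    u ∈ centMod N c ↔ Commute (QuotientGroup.mk' N u) (QuotientGroup.mk' N c) := by
  rw [centMod, Subgroup.mem_comap, Subgroup.mem_centralizer_singleton_iff]
  rfl

theorem mem_centMod_comm {u c : G} : u ∈ centMod N c ↔ c ∈ centMod N u := by
  rw [mem_centMod, mem_centMod, commute_iff_eq, commute_iff_eq, eq_comm]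

theorem gcomm_mem_iff {u c : G} : gcomm u c ∈ N ↔ u ∈ centMod N c := by
  rw [mem_centMod, ← gcomm_eq_one_iff, ← map_gcomm, QuotientGroup.mk'_apply,
    QuotientGroup.eq_one_iff]

theorem gcomm_mem_iff' {u c : G} : gcomm u c ∈ N ↔ c ∈ centMod N u := by
  rw [gcomm_mem_iff, mem_centMod_comm]

theorem commutator_mem_iff {u c : G} : ⁅u, c⁆ ∈ N ↔ u ∈ centMod N c := by
  rw [← inv_inv u, ← inv_inv c, ← gcomm_eq, gcomm_mem_iff, inv_inv, inv_inv, mem_centMod,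
    mem_centMod, map_inv, map_inv, Commute.inv_inv_iff]

theorem gcomm_mem_of_rotate {d e c : G} (h₁ : gcomm e⁻¹ c⁻¹ ∈ centMod N d)
    (h₂ : gcomm c d⁻¹ ∈ centMod N e) : gcomm d e ∈ centMod N c := by
  rw [mem_centMod] at *
  rw [map_gcomm] at *
  rw [map_inv] at *
  rw [map_inv] at h₁
  exact commute_gcomm_of_rotate h₁ h₂

end Commutators

/-! ### Commutators of terms of the lower central series. -/

section LowerCentralSeries

variable {G : Type*} [Group G]

instance lcs_normal (n : ℕ) : (lcs G n).Normal := by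
  unfold lcs; infer_instance

theorem lcs_succ {n : ℕ} (hn : 1 ≤ n) : lcs G (n + 1) = ⁅lcs G n, ⊤⁆ := by
  obtain ⟨m, rfl⟩ := Nat.exists_eq_add_of_le' hn
  rfl

theorem lcs_antitone : Antitone (lcs G) := fun _ _ h =>
  Subgroup.lowerCentralSeries_antitone _ (Nat.sub_le_sub_right h 1)

theorem lcs_succ_le_centMod {n : ℕ} (hn : 1 ≤ n) {N : Subgroup G} [N.Normal]
    (hN : lcs G (n + 1) ≤ N) (c : G) : lcs G n ≤ centMod N c := fun g hg => by
  rw [← commutator_mem_iff]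
  apply hN
  rw [lcs_succ hn]
  exact Subgroup.commutator_mem_commutator hg (Subgroup.mem_top c)

/-- Induction on `p` for all `q` at once: testing `[a, b]` with `a ∈ lcs p` against `c ∈ lcs q`
rotates to `[b⁻¹, c⁻¹] ∈ lcs (q + 1)` against `a`, where the induction hypothesis is needed for `q +
1`, and to `[c, a⁻¹] ∈ lcs (p + q)` against `b`. -/
theorem lcs_le_centMod {p q : ℕ} (hp : 1 ≤ p) (hq : 1 ≤ q) {c : G} (hc : c ∈ lcs G q) :
    lcs G p ≤ centMod (lcs G (p + q)) c := by
  induction p, hp using Nat.le_induction generalizing q c with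
  | base =>
    intro g _
    rw [mem_centMod_comm]
    have := lcs_succ_le_centMod hq (le_refl _) g hc
    rwa [add_comm] at this
  | succ p hp ih =>
    rw [lcs_succ hp, Subgroup.commutator_le]
    intro g hg h _
    have key : ∀ a ∈ lcs G p, ∀ b : G, gcomm a b ∈ centMod (lcs G (p + 1 + q)) c := by
      intro a ha b
      apply gcomm_mem_of_rotate
      · rw [mem_centMod_comm]
        have hb : gcomm b⁻¹ c⁻¹ ∈ lcs G (q + 1) := by
          rw [gcomm_mem_iff']
          exact lcs_succ_le_centMod hq (le_refl _) _ (inv_mem hc)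
        have := ih (Nat.le_add_left 1 q) hb ha
        rwa [show p + (q + 1) = p + 1 + q by ring] at this
      · have hb : gcomm c a⁻¹ ∈ lcs G (p + q) := by
          rw [gcomm_mem_iff']
          exact ih hq hc (inv_mem ha)
        exact lcs_succ_le_centMod (by omega) (by rw [show p + 1 + q = p + q + 1 by ring]) _ hb
    have := key g⁻¹ (inv_mem hg) h⁻¹
    rwa [gcomm_eq, inv_inv, inv_inv] at this

theorem gcomm_mem_lcs {p q : ℕ} (hp : 1 ≤ p) (hq : 1 ≤ q) {a b : G} (ha : a ∈ lcs G p)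
    (hb : b ∈ lcs G q) : gcomm a b ∈ lcs G (p + q) :=
  gcomm_mem_iff.2 (lcs_le_centMod hp hq hb ha)

end LowerCentralSeries

/-! ### Basic commutators generate the lower central quotients. -/

section HallGeneration

variable {k : ℕ} {lt : FreeMagma (Fin k) → FreeMagma (Fin k) → Prop}

theorem finite_length_le (k w : ℕ) : {t : FreeMagma (Fin k) | t.length ≤ w}.Finite := by
  induction w with
  | zero =>
    convert Set.finite_empty
    ext t
    simpa using t.length_pos.ne'
  | succ w ih =>
    refine ((Set.finite_range FreeMagma.of).union (ih.image2 FreeMagma.mul ih)).subset ?_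
    rintro (i | ⟨b, c⟩) h
    · exact Or.inl ⟨i, rfl⟩
    · have hb := b.length_pos
      have hc := c.length_pos
      change b.length + c.length ≤ w + 1 at h
      exact Or.inr ⟨b, show b.length ≤ w by omega, c, show c.length ≤ w by omega, rfl⟩

theorem eval_mem_lcs (t : FreeMagma (Fin k)) : eval t ∈ lcs (FreeGroup (Fin k)) t.length := by
  induction t with
  | ih1 i => exact Subgroup.mem_top _
  | ih2 b c hb hc => exact gcomm_mem_lcs b.length_pos c.length_pos hb hc

theorem IsCommutatorOrder.length_le (hlt : IsCommutatorOrder lt) {a b : FreeMagma (Fin k)}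
    (h : lt a b) : a.length ≤ b.length := by
  by_contra! h'
  have := hlt.total
  exact asymm h (hlt.weight _ _ h')

/-- The values of the basic commutators of weight `w`. -/
def basicSet (lt : FreeMagma (Fin k) → FreeMagma (Fin k) → Prop) (w : ℕ) :
    Set (FreeGroup (Fin k)) :=
  eval '' {t | IsBasic lt t ∧ t.length = w}

/-- The subgroup generated by the basic commutators of weight `w` modulo `lcs (w + 1)`. -/
def basicSpan (lt : FreeMagma (Fin k) → FreeMagma (Fin k) → Prop) (w : ℕ) :
    Subgroup (FreeGroup (Fin k)) :=
  Subgroup.closure (basicSet lt w) ⊔ lcs _ (w + 1)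

theorem lcs_succ_le_basicSpan (w : ℕ) : lcs _ (w + 1) ≤ basicSpan lt w := le_sup_right

theorem eval_mem_basicSpan {t : FreeMagma (Fin k)} (ht : IsBasic lt t) :
    eval t ∈ basicSpan lt t.length :=
  le_sup_left (a := Subgroup.closure _) (Subgroup.subset_closure ⟨t, ⟨ht, rfl⟩, rfl⟩)

theorem basicSpan_le (w : ℕ) : basicSpan lt w ≤ lcs _ w := by
  refine sup_le ?_ (lcs_antitone (Nat.le_succ w))
  rw [Subgroup.closure_le]
  rintro _ ⟨t, ⟨-, rfl⟩, rfl⟩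
  exact eval_mem_lcs t

/-- Conjugation changes an element of `lcs w` only by a factor in `lcs (w + 1)`. -/
theorem normal_of_lcs_sandwich {G : Type*} [Group G] {w : ℕ} (hw : 1 ≤ w) {S : Subgroup G}
    (h₁ : lcs G (w + 1) ≤ S) (h₂ : S ≤ lcs G w) : S.Normal where
  conj_mem n hn g := by
    have h : ⁅n, g⁆ ∈ lcs G (w + 1) := by
      rw [lcs_succ hw]
      exact Subgroup.commutator_mem_commutator (h₂ hn) (Subgroup.mem_top g)
    rw [show g * n * g⁻¹ = ⁅n, g⁆⁻¹ * n by simp [commutatorElement_def, mul_assoc]]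
    exact S.mul_mem (inv_mem (h₁ h)) hn

theorem basicSpan_normal {w : ℕ} (hw : 1 ≤ w) : (basicSpan lt w).Normal :=
  normal_of_lcs_sandwich hw (lcs_succ_le_basicSpan w) (basicSpan_le w)

/-- If the lower weights are spanned by basic commutators, a term of the lower central series
centralizes `c` modulo `N` as soon as the basic commutators of its weight do. -/
theorem lcs_le_centMod_of_basic {N : Subgroup (FreeGroup (Fin k))} [N.Normal] {p q : ℕ}
    (hp : lcs _ p ≤ basicSpan lt p) (hq : 1 ≤ q)
    (hN : lcs _ (p + 1 + q) ≤ N) {c : FreeGroup (Fin k)} (hc : c ∈ lcs _ q)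
    (h : ∀ t, IsBasic lt t → t.length = p → eval t ∈ centMod N c) :
    lcs _ p ≤ centMod N c := by
  refine hp.trans (sup_le ?_ ?_)
  · rw [Subgroup.closure_le]
    rintro _ ⟨t, ⟨ht, hl⟩, rfl⟩
    exact h t ht hl
  · intro g hg
    rw [← gcomm_mem_iff]
    exact hN (gcomm_mem_lcs (by omega) hq hg hc)

/-- Descending induction on the smaller entry `c`. If `[b, c]` fails to be basic, then `b = [d, e]`
with `e > c`, and rotation leaves `[e⁻¹, c⁻¹]` against `d` and `[c, d⁻¹]` against `e`. By generation
in lower weights the inner commutators are products of basic commutators heavier than `c`. So only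
pairs of basic commutators that both exceed `c` remain, and these fall under the induction
hypothesis. -/
theorem gcomm_basic_mem (hlt : IsCommutatorOrder lt) {w : ℕ}
    (ih : ∀ v, 1 ≤ v → v < w → lcs _ v ≤ basicSpan lt v) (c : FreeMagma (Fin k)) :
    ∀ b, IsBasic lt b → IsBasic lt c → lt c b → b.length + c.length = w →
      gcomm (eval b) (eval c) ∈ basicSpan lt w := by
  have := hlt.total
  -- There are only finitely many formal commutators of bounded weight, so the reversed order is
  -- well-founded on them.
  have wf : {t : FreeMagma (Fin k) | t.length ≤ w}.WellFoundedOn (Function.swap lt) :=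
    (finite_length_le k w).wellFoundedOn
  by_cases hcw : c.length ≤ w
  swap
  · intro b _ _ _ h; omega
  refine wf.induction (P := fun c => ∀ b, IsBasic lt b → IsBasic lt c → lt c b →
    b.length + c.length = w → gcomm (eval b) (eval c) ∈ basicSpan lt w) hcw ?_
  clear hcw c
  intro c hcw IH b hb hc hcb hw
  have hb1 := b.length_pos
  have hc1 := c.length_pos
  have := basicSpan_normal (lt := lt) (w := w) (by omega)
  -- basic commutators above `c` of complementary weights commute
  have comm : ∀ h e, IsBasic lt h → IsBasic lt e → lt c h → lt c e → h.length + e.length = w →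
      eval h ∈ centMod (basicSpan lt w) (eval e) := by
    intro h e hh he hch hce hl
    rcases trichotomous_of lt h e with h1 | rfl | h1
    · rw [← gcomm_mem_iff']
      have h1' := h.length_pos
      exact IH h (show h.length ≤ w by have := e.length_pos; omega) hch e he hh h1 (by omega)
    · rw [mem_centMod]
    · rw [← gcomm_mem_iff]
      exact IH e (show e.length ≤ w by have := h.length_pos; omega) hce h hh he h1 hl
  have basic_case : IsBasic lt (.mul b c) → gcomm (eval b) (eval c) ∈ basicSpan lt w := by
    intro h
    have := eval_mem_basicSpan h
    change _ ∈ basicSpan lt (b.length + c.length) at this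
    rwa [hw] at this
  cases b with
  | of i => exact basic_case ⟨hb, hc, hcb, by simp⟩
  | mul d e =>
    by_cases hec : e = c ∨ lt e c
    · refine basic_case ⟨hb, hc, hcb, ?_⟩
      intro d' e' h
      cases h
      exact hec
    · have hce : lt c e := by
        rcases trichotomous_of lt c e with h | h | h
        · exact h
        · exact (hec (Or.inl h.symm)).elim
        · exact (hec (Or.inr h)).elim
      obtain ⟨hd, he, hed, -⟩ := hb
      have hcd : lt c d := _root_.trans hce hed
      change d.length + e.length + c.length = w at hw
      have hd1 := d.length_pos
      have he1 := e.length_pos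
      have lt_of : ∀ h : FreeMagma (Fin k), c.length < h.length → lt c h := fun h hh =>
        hlt.weight _ _ hh
      rw [gcomm_mem_iff]
      apply gcomm_mem_of_rotate
      · refine lcs_le_centMod_of_basic (lt := lt) (p := e.length + c.length) (q := d.length)
          (ih _ (by omega) (by omega)) hd1 ?_ (eval_mem_lcs d) ?_ ?_
        · rw [show e.length + c.length + 1 + d.length = w + 1 by omega]
          exact lcs_succ_le_basicSpan w
        · intro t ht hl
          exact comm t d ht hd (lt_of t (by omega)) hcd (by omega)
        · exact gcomm_mem_lcs he1 hc1 (inv_mem (eval_mem_lcs e)) (inv_mem (eval_mem_lcs c))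
      · refine lcs_le_centMod_of_basic (lt := lt) (p := c.length + d.length) (q := e.length)
          (ih _ (by omega) (by omega)) he1 ?_ (eval_mem_lcs e) ?_ ?_
        · rw [show c.length + d.length + 1 + e.length = w + 1 by omega]
          exact lcs_succ_le_basicSpan w
        · intro t ht hl
          exact comm t e ht he (lt_of t (by omega)) hce (by omega)
        · exact gcomm_mem_lcs hc1 hd1 (eval_mem_lcs c) (inv_mem (eval_mem_lcs d))

theorem eq_top_of_of_mem {S : Subgroup (FreeGroup (Fin k))}
    (h : ∀ i, FreeGroup.of i ∈ S) : S = ⊤ := by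
  rw [eq_top_iff, ← FreeGroup.closure_range_of, Subgroup.closure_le]
  rintro _ ⟨i, rfl⟩
  exact h i

/-- The basic commutators of weight `w` generate `lcs w` modulo `lcs (w + 1)`. -/
theorem lcs_le_basicSpan (hlt : IsCommutatorOrder lt) {w : ℕ} (hw : 1 ≤ w) :
    lcs _ w ≤ basicSpan lt w := by
  have := hlt.total
  induction w using Nat.strong_induction_on with
  | h w ih =>
  obtain rfl | hw2 := hw.eq_or_lt
  · rw [eq_top_of_of_mem (S := basicSpan lt 1)]
    · exact le_top
    · intro i
      exact eval_mem_basicSpan (t := FreeMagma.of i) trivial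
  obtain ⟨v, rfl⟩ := Nat.exists_eq_add_of_lt hw2
  rw [show 1 + v + 1 = v + 1 + 1 by ring] at *
  have hv : lcs _ (v + 1) ≤ basicSpan lt (v + 1) := ih _ (by omega) (by omega)
  have := basicSpan_normal (lt := lt) (w := v + 1 + 1) (by omega)
  rw [lcs_succ (by omega), Subgroup.commutator_le]
  intro g hg h _
  rw [commutator_mem_iff]
  refine lcs_le_centMod_of_basic (lt := lt) (q := 1) hv le_rfl (lcs_succ_le_basicSpan _)
    (Subgroup.mem_top _) ?_ hg
  intro t ht hl
  rw [mem_centMod_comm]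
  -- The elements commuting with `eval t` form a subgroup, so the free generators suffice. A letter
  -- and `t` are both basic, and `gcomm_basic_mem` applies whichever of them is larger.
  suffices h' : centMod (basicSpan lt (v + 1 + 1)) (eval t) = ⊤ by rw [h']; trivial
  apply eq_top_of_of_mem
  intro i
  change eval (FreeMagma.of i) ∈ _
  have key := gcomm_basic_mem hlt (w := v + 1 + 1) (fun u h1 h2 => ih u (by omega) h1)
  rcases trichotomous_of lt (FreeMagma.of i) t with h1 | rfl | h1
  · rw [← gcomm_mem_iff']
    exact key _ t ht trivial h1 (by rw [hl]; rfl)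
  · rw [mem_centMod]
  · rw [← gcomm_mem_iff]
    exact key _ _ trivial ht h1 (by rw [hl]; exact add_comm _ _)

end HallGeneration

/-! ### Lazard elimination in the free associative algebra. -/

section Elimination

variable {R : Type*} [CommRing R]

/-- A family in an algebra is free if it satisfies no polynomial relation in non-commuting
variables. -/
def FreeFamily (R : Type*) [CommRing R] {A Y : Type*} [Ring A] [Algebra R A] (f : Y → A) : Prop :=
  Function.Injective (FreeAlgebra.lift R f)

theorem freeFamily_ι (Y : Type*) : FreeFamily R (FreeAlgebra.ι R : Y → FreeAlgebra R Y) := by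
  have : FreeAlgebra.lift R (FreeAlgebra.ι R : Y → FreeAlgebra R Y) = AlgHom.id R _ := by
    ext; simp
  rw [FreeFamily, this]
  exact fun _ _ h => h

/-- Sending the variables outside the range of `g` to `0` gives a left inverse of the renaming map.
-/
theorem FreeFamily.comp {A Y Z : Type*} [Ring A] [Algebra R A] {f : Y → A}
    (hf : FreeFamily R f) {g : Z → Y} (hg : Function.Injective g) : FreeFamily R (f ∘ g) := by
  classical
  have h1 : FreeAlgebra.lift R (f ∘ g) =
      (FreeAlgebra.lift R f).comp (FreeAlgebra.lift R (FreeAlgebra.ι R ∘ g)) := by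
    ext; simp
  have h2 : (FreeAlgebra.lift R
      (fun y => if h : ∃ z, g z = y then FreeAlgebra.ι R h.choose else 0)).comp
      (FreeAlgebra.lift R (FreeAlgebra.ι R ∘ g)) = AlgHom.id R (FreeAlgebra R Z) := by
    ext z
    have h : ∃ z', g z' = g z := ⟨z, rfl⟩
    simp only [Function.comp_apply, AlgHom.coe_comp, FreeAlgebra.lift_ι_apply, AlgHom.coe_id, id]
    rw [dif_pos h, hg h.choose_spec]
  rw [FreeFamily, h1, AlgHom.coe_comp]
  refine Function.Injective.comp hf ?_
  exact Function.LeftInverse.injective (fun x => DFunLike.congr_fun h2 x)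

theorem FreeFamily.linearIndependent {A Y : Type*} [Ring A] [Algebra R A] {f : Y → A}
    (hf : FreeFamily R f) : LinearIndependent R f := by
  have h1 : LinearIndependent R (FreeAlgebra.ι R : Y → FreeAlgebra R Y) := by
    have := (FreeAlgebra.basisFreeMonoid R Y).linearIndependent.comp FreeMonoid.of
      FreeMonoid.of_injective
    convert this
    ext y
    simp [FreeAlgebra.basisFreeMonoid, FreeAlgebra.equivMonoidAlgebraFreeMonoid]
  have h2 := h1.map' (FreeAlgebra.lift R f).toLinearMap (LinearMap.ker_eq_bot.2 hf)
  rwa [show (FreeAlgebra.lift R f).toLinearMap ∘ FreeAlgebra.ι R = f by ext y; simp] at h2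

variable (R) {Y : Type*}

/-- The algebra homomorphism `u ↦ u + D u` to the dual numbers, where `D` is the derivation that
raises the second index of each generator. -/
def shiftHom : FreeAlgebra R (Y × ℕ) →ₐ[R] DualNumber (FreeAlgebra R (Y × ℕ)) :=
  FreeAlgebra.lift R fun z => TrivSqZeroExt.inl (FreeAlgebra.ι R z) +
    TrivSqZeroExt.inr (FreeAlgebra.ι R (z.1, z.2 + 1))

/-- The derivation that raises the second index of each generator. -/
def shiftDer : FreeAlgebra R (Y × ℕ) →ₗ[R] FreeAlgebra R (Y × ℕ) :=
  (TrivSqZeroExt.sndHom (FreeAlgebra R (Y × ℕ)) (FreeAlgebra R (Y × ℕ))).restrictScalars R ∘ₗ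
    (shiftHom R).toLinearMap

theorem fst_shiftHom (u : FreeAlgebra R (Y × ℕ)) : (shiftHom R u).fst = u := by
  have : (TrivSqZeroExt.fstHom R (FreeAlgebra R (Y × ℕ)) (FreeAlgebra R (Y × ℕ))).comp
      (shiftHom R) = AlgHom.id R _ := by
    ext z
    simp [shiftHom]
  exact DFunLike.congr_fun this u

theorem shiftDer_mul (u v : FreeAlgebra R (Y × ℕ)) :
    shiftDer R (u * v) = u * shiftDer R v + shiftDer R u * v := by
  change (shiftHom R (u * v)).snd = u * (shiftHom R v).snd + (shiftHom R u).snd * v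
  rw [map_mul, TrivSqZeroExt.snd_mul, fst_shiftHom, fst_shiftHom]
  rfl

theorem shiftDer_ι (z : Y × ℕ) :
    shiftDer R (FreeAlgebra.ι R z) = FreeAlgebra.ι R (z.1, z.2 + 1) := by
  change (shiftHom R _).snd = _
  simp [shiftHom]

/-- Iterated right bracketing `[…[b, c], …, c]`. -/
def adIter {A : Type*} [Ring A] (c b : A) (j : ℕ) : A := (fun u => u * c - c * u)^[j] b

theorem adIter_succ {A : Type*} [Ring A] (c b : A) (j : ℕ) :
    adIter c b (j + 1) = adIter c b j * c - c * adIter c b j := by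
  rw [adIter, Function.iterate_succ_apply']; rfl

theorem map_adIter {A B : Type*} [Ring A] [Ring B] (φ : A →+* B) (c b : A) (j : ℕ) :
    φ (adIter c b j) = adIter (φ c) (φ b) j := by
  induction j with
  | zero => rfl
  | succ j ih => simp [adIter_succ, ih]

open Classical in
/-- The action of the free algebra on the algebra of its eliminated generators: the generator `c`
acts as the negative of the shift derivation, any other by left multiplication. -/
noncomputable def elimAction (c : Y) :
    FreeAlgebra R Y →ₐ[R] Module.End R (FreeAlgebra R ({b : Y // b ≠ c} × ℕ)) :=
  FreeAlgebra.lift R fun y => if h : y = c then -shiftDer R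
    else LinearMap.mulLeft R (FreeAlgebra.ι R (⟨y, h⟩, 0))

/-- By the Leibniz rule the bracket of left multiplication by `u` with `-D` is left multiplication
by `D u`. So each bracketing with `c` raises the second index by one. -/
theorem elimAction_adIter (c : Y) (b : {b : Y // b ≠ c}) (j : ℕ) :
    elimAction R c (adIter (FreeAlgebra.ι R c) (FreeAlgebra.ι R b.1) j) =
      LinearMap.mulLeft R (FreeAlgebra.ι R (b, j)) := by
  induction j with
  | zero => simp [adIter, elimAction, b.2]
  | succ j ih =>
    rw [adIter_succ, map_sub, map_mul, map_mul, ih]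
    ext m
    simp [elimAction, shiftDer_mul, shiftDer_ι]

/-- A polynomial in the brackets acts as left multiplication by the same polynomial in the new
variables; evaluating this operator at `1` recovers the polynomial. -/
theorem freeFamily_adIter_ι (c : Y) : FreeFamily R fun z : {b : Y // b ≠ c} × ℕ =>
    adIter (FreeAlgebra.ι R c) (FreeAlgebra.ι R z.1.1) z.2 := by
  have h : (elimAction R c).comp (FreeAlgebra.lift R fun z : {b : Y // b ≠ c} × ℕ =>
      adIter (FreeAlgebra.ι R c) (FreeAlgebra.ι R z.1.1) z.2) = Algebra.lmul R _ := by
    ext z : 2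
    simp only [Function.comp_apply, AlgHom.coe_comp, FreeAlgebra.lift_ι_apply]
    exact elimAction_adIter R c z.1 z.2
  refine Function.LeftInverse.injective (g := fun u => elimAction R c u 1) fun u => ?_
  have := congrArg (fun f => f 1) (DFunLike.congr_fun h u)
  simpa using this

variable {R}

theorem FreeFamily.adIter {A : Type*} [Ring A] [Algebra R A] {f : Y → A}
    (hf : FreeFamily R f) (c : Y) :
    FreeFamily R fun z : {b : Y // b ≠ c} × ℕ => adIter (f c) (f z.1.1) z.2 := by
  have h : FreeAlgebra.lift R (fun z : {b : Y // b ≠ c} × ℕ => RelBasic.adIter (f c) (f z.1.1) z.2)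
      = (FreeAlgebra.lift R f).comp (FreeAlgebra.lift R fun z : {b : Y // b ≠ c} × ℕ =>
      RelBasic.adIter (FreeAlgebra.ι R c) (FreeAlgebra.ι R z.1.1) z.2) := by
    ext z
    have := map_adIter (FreeAlgebra.lift R f).toRingHom (FreeAlgebra.ι R c)
      (FreeAlgebra.ι R z.1.1) z.2
    simpa using this.symm
  rw [FreeFamily, h, AlgHom.coe_comp]
  exact Function.Injective.comp hf (freeFamily_adIter_ι R c)

end Elimination

/-! ### Linear independence of the basic Lie polynomials. -/

section LiePolynomials

variable (R : Type*) [CommRing R] {k : ℕ} {lt : FreeMagma (Fin k) → FreeMagma (Fin k) → Prop}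

/-- The Lie polynomial denoted by a formal commutator. -/
def liePoly : FreeMagma (Fin k) → FreeAlgebra R (Fin k)
  | .of i => FreeAlgebra.ι R i
  | .mul b c => liePoly b * liePoly c - liePoly c * liePoly b

/-- The generators left after eliminating the basic commutators in `L`. -/
def remaining (lt : FreeMagma (Fin k) → FreeMagma (Fin k) → Prop)
    (L : Finset (FreeMagma (Fin k))) : Set (FreeMagma (Fin k)) :=
  {b | IsBasic lt b ∧ b ∉ L ∧ ∀ d e, b = .mul d e → e ∈ L}

theorem liePoly_iterate (c b : FreeMagma (Fin k)) (j : ℕ) :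
    liePoly R ((fun u => FreeMagma.mul u c)^[j] b) = adIter (liePoly R c) (liePoly R b) j := by
  induction j with
  | zero => rfl
  | succ j ih => rw [Function.iterate_succ_apply', adIter_succ, ← ih]; rfl

/-- This matches the definition of basic commutators with elimination. A generator `[d, e]`
remaining after `c` is removed either has `e ∈ L` and was there before, or has `e = c`. In the
latter case the right entry of `d` is at most `c`, so `d` itself remains after `c` is removed and
the argument recurs. -/
theorem exists_iterate_of_mem_remaining [DecidableEq (FreeMagma (Fin k))]
    (hlt : IsCommutatorOrder lt)
    {L : Finset (FreeMagma (Fin k))} {c : FreeMagma (Fin k)}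
    (hc : ∀ l ∈ L, lt l c) (hlow : ∀ b, IsBasic lt b → lt b c → b ∈ L)
    {t : FreeMagma (Fin k)} (ht : t ∈ remaining lt (insert c L)) :
    ∃ b ∈ remaining lt L, b ≠ c ∧ ∃ j, t = (fun u => FreeMagma.mul u c)^[j] b := by
  have := hlt.total
  induction t with
  | ih1 i =>
    refine ⟨FreeMagma.of i, ⟨trivial, fun h => ht.2.1 (Finset.mem_insert_of_mem h), fun _ _ h => ?_⟩,
      fun h => ht.2.1 (h ▸ Finset.mem_insert_self _ _), 0, rfl⟩
    cases h
  | ih2 d e ihd _ =>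
    change FreeMagma.mul d e ∈ _ at ht
    change ∃ b ∈ remaining lt L, b ≠ c ∧ ∃ j, FreeMagma.mul d e = _
    rcases Finset.mem_insert.1 (ht.2.2 d e rfl) with rfl | he
    · obtain ⟨hd, he, hed, hde⟩ := ht.1
      have hrem : d ∈ remaining lt (insert e L) := by
        refine ⟨hd, fun h => ?_, fun d' e' h => ?_⟩
        · rcases Finset.mem_insert.1 h with rfl | h
          · exact irrefl _ hed
          · exact asymm hed (hc _ h)
        · rcases hde d' e' h with rfl | h'
          · exact Finset.mem_insert_self _ _
          · subst h
            exact Finset.mem_insert_of_mem (hlow _ hd.2.1 h')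
      obtain ⟨b, hb, hbe, j, rfl⟩ := ihd hrem
      exact ⟨b, hb, hbe, j + 1, by rw [Function.iterate_succ_apply']⟩
    · refine ⟨_, ⟨ht.1, fun h => ht.2.1 (Finset.mem_insert_of_mem h), fun d' e' h => ?_⟩,
        fun h => ht.2.1 (h ▸ Finset.mem_insert_self _ _), 0, rfl⟩
      cases h
      exact he

/-- The members of the initial segment `L` are eliminated in increasing order. Before any
elimination the remaining generators are the letters, and each step preserves freeness by
`FreeFamily.adIter`. -/
theorem freeFamily_remaining (hlt : IsCommutatorOrder lt) (L : Finset (FreeMagma (Fin k)))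
    (hL : ∀ l ∈ L, IsBasic lt l) (hlow : ∀ l ∈ L, ∀ b, IsBasic lt b → lt b l → b ∈ L) :
    FreeFamily R fun t : remaining lt L => liePoly R t.1 := by
  classical
  have := hlt.total
  let _ : LinearOrder (FreeMagma (Fin k)) := linearOrderOfSTO lt
  induction L using Finset.induction_on_max with
  | empty =>
    have h : ∀ t : remaining lt ∅, ∃ i, t.1 = FreeMagma.of i := by
      rintro ⟨i | ⟨d, e⟩, ht⟩
      · exact ⟨i, rfl⟩
      · exact absurd (ht.2.2 d e rfl) (Finset.notMem_empty _)
    choose g hg using h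
    have := (freeFamily_ι (R := R) (Fin k)).comp (g := g) fun s t hst => by
      rw [Subtype.ext_iff, hg, hg, hst]
    convert this
    rename_i t
    rw [hg]
    rfl
  | insert c L hc ih =>
    have hcL : ∀ b, IsBasic lt b → lt b c → b ∈ L := fun b hb hbc => by
      rcases Finset.mem_insert.1 (hlow c (Finset.mem_insert_self _ _) b hb hbc) with rfl | h
      · exact (irrefl _ hbc).elim
      · exact h
    have hcb := hL c (Finset.mem_insert_self _ _)
    have ih' := ih (fun l hl => hL l (Finset.mem_insert_of_mem hl)) fun l hl b hb hbl =>
      hcL b hb (_root_.trans hbl (hc l hl))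
    have hcm : c ∈ remaining lt L := by
      refine ⟨hcb, fun h => irrefl _ (hc c h), fun d e h => ?_⟩
      subst h
      refine hcL e hcb.2.1 (hlt.weight _ _ ?_)
      exact Nat.lt_add_of_pos_left d.length_pos
    have h : ∀ t : remaining lt (insert c L), ∃ z : {b : remaining lt L // b ≠ ⟨c, hcm⟩} × ℕ,
        t.1 = (fun u => FreeMagma.mul u c)^[z.2] z.1.1.1 := by
      rintro ⟨t, ht⟩
      obtain ⟨b, hb, hbc, j, h⟩ := exists_iterate_of_mem_remaining hlt hc hcL ht
      exact ⟨⟨⟨⟨b, hb⟩, fun h => hbc (congrArg Subtype.val h)⟩, j⟩, h⟩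
    choose g hg using h
    have := (ih'.adIter ⟨c, hcm⟩).comp (g := g) fun s t hst => by
      rw [Subtype.ext_iff, hg, hg, hst]
    convert this
    rename_i t
    rw [hg, liePoly_iterate]
    rfl

/-- The Lie polynomials of the basic commutators of a given weight are linearly independent. -/
theorem linearIndependent_liePoly (hlt : IsCommutatorOrder lt) (w : ℕ) :
    LinearIndependent R
      fun t : {t : FreeMagma (Fin k) // IsBasic lt t ∧ t.length = w} => liePoly R t.1 := by
  classical
  -- Everything of weight below `w` is eliminated. A basic commutator of weight `w` then remains,
  -- since its right entry has smaller weight.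
  have hfin : {t : FreeMagma (Fin k) | IsBasic lt t ∧ t.length < w}.Finite :=
    (finite_length_le k w).subset fun t ht => ht.2.le
  have hf := freeFamily_remaining R hlt hfin.toFinset (fun l hl => (hfin.mem_toFinset.1 hl).1)
    fun l hl b hb hbl => hfin.mem_toFinset.2
      ⟨hb, (hlt.length_le hbl).trans_lt (hfin.mem_toFinset.1 hl).2⟩
  have hmem : ∀ t : {t : FreeMagma (Fin k) // IsBasic lt t ∧ t.length = w},
      t.1 ∈ remaining lt hfin.toFinset := by
    rintro ⟨t, ht, rfl⟩
    refine ⟨ht, fun h => (hfin.mem_toFinset.1 h).2.ne rfl, ?_⟩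
    rintro d e rfl
    exact hfin.mem_toFinset.2 ⟨ht.2.1, Nat.lt_add_of_pos_left d.length_pos⟩
  exact hf.linearIndependent.comp (fun t => ⟨t.1, hmem t⟩)
    fun s t h => Subtype.ext (congrArg (fun x => x.1) h)

end LiePolynomials

/-! ### Ordered products with central corrections. -/

section Products

variable {G : Type*} [Group G]

theorem prod_ofFn_mul_of_commute {n : ℕ} (a b : Fin n → G) (h : ∀ i g, Commute (b i) g) :
    (List.ofFn fun i => a i * b i).prod = (List.ofFn a).prod * (List.ofFn b).prod := by
  induction n with
  | zero => simp
  | succ n ih =>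
    simp only [List.ofFn_succ, List.prod_cons]
    rw [ih (fun i => a i.succ) (fun i => b i.succ) fun i g => h _ g, mul_assoc, mul_assoc,
      ← mul_assoc (b 0), (h 0 _).eq, mul_assoc]

theorem prod_ofFn_eq_of_unique {n : ℕ} (f : Fin n → G) (i : Fin n) (h : ∀ j, j ≠ i → f j = 1) :
    (List.ofFn f).prod = f i := by
  induction n with
  | zero => exact i.elim0
  | succ n ih =>
    rw [List.ofFn_succ, List.prod_cons]
    cases i using Fin.cases with
    | zero =>
      rw [show (fun i : Fin n => f i.succ) = fun _ => 1 from
        funext fun j => h _ (Fin.succ_ne_zero j)]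
      simp
    | succ i =>
      rw [h 0 (Fin.succ_ne_zero i).symm, one_mul,
        ih (fun i => f i.succ) i fun j hj => h _ fun e => hj (Fin.succ_injective _ e)]

/-- Factors that are central modulo `N` can be gathered at the end. This is what permits changing
exponents inside a product whose order is prescribed. -/
theorem prod_ofFn_mul_mod {N : Subgroup G} [N.Normal] {n : ℕ} (a b : Fin n → G)
    (h : ∀ i g, b i ∈ centMod N g) :
    ((List.ofFn a).prod * (List.ofFn b).prod)⁻¹ * (List.ofFn fun i => a i * b i).prod ∈ N := by
  rw [← QuotientGroup.eq, ← QuotientGroup.mk'_apply, ← QuotientGroup.mk'_apply, map_mul,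
    map_list_prod, map_list_prod, map_list_prod, List.map_ofFn, List.map_ofFn, List.map_ofFn]
  rw [← prod_ofFn_mul_of_commute]
  · simp [Function.comp_def]
  · intro i g
    obtain ⟨g, rfl⟩ := QuotientGroup.mk'_surjective N g
    exact mem_centMod.1 (h i g)

/-- If the entries of a tuple indexed by `I` are central modulo `N`, then each element of the
subgroup they generate with `N` is congruent to an ordered product of their powers. -/
theorem exists_prod_zpow {N : Subgroup G} [N.Normal] {n : ℕ} (r : Fin n → G) (I : Set (Fin n))
    (h : ∀ i ∈ I, ∀ g, r i ∈ centMod N g) {g : G} (hg : g ∈ Subgroup.closure (r '' I) ⊔ N) :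
    ∃ β : Fin n → ℤ, (∀ i, i ∉ I → β i = 0) ∧ g⁻¹ * (List.ofFn fun i => r i ^ β i).prod ∈ N := by
  classical
  have hc : ∀ β : Fin n → ℤ, (∀ i, i ∉ I → β i = 0) → ∀ i g, r i ^ β i ∈ centMod N g := by
    intro β hβ i g
    by_cases hi : i ∈ I
    · exact zpow_mem (h i hi g) _
    · rw [hβ i hi, zpow_zero]; exact one_mem _
  -- Centrality makes exponents add, so the elements with such an expression form a subgroup; it
  -- contains the generators and `N`.
  let T : Subgroup G :=
    { carrier := {g | ∃ β : Fin n → ℤ, (∀ i, i ∉ I → β i = 0) ∧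
        (g : G ⧸ N) = (List.ofFn fun i => r i ^ β i).prod}
      one_mem' := ⟨0, by simp, by simp⟩
      mul_mem' := by
        rintro a b ⟨α, hα, ha⟩ ⟨β, hβ, hb⟩
        refine ⟨α + β, fun i hi => by simp [hα i hi, hβ i hi], ?_⟩
        have := prod_ofFn_mul_mod (fun i => r i ^ α i) _ (hc β hβ)
        rw [← QuotientGroup.eq] at this
        simp only [Pi.add_apply, zpow_add]
        rw [← this, QuotientGroup.mk_mul, QuotientGroup.mk_mul, ha, hb]
      inv_mem' := by
        rintro a ⟨α, hα, ha⟩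
        refine ⟨-α, fun i hi => by simp [hα i hi], ?_⟩
        have := prod_ofFn_mul_mod (fun i => r i ^ α i) _
          (hc (-α) fun i hi => by simp [hα i hi])
        rw [← QuotientGroup.eq] at this
        rw [QuotientGroup.mk_inv, ha, inv_eq_iff_mul_eq_one, ← QuotientGroup.mk_mul, this]
        simp }
  have hT : Subgroup.closure (r '' I) ⊔ N ≤ T := by
    refine sup_le ((Subgroup.closure_le _).2 ?_) ?_
    · rintro _ ⟨i, hi, rfl⟩
      refine ⟨Pi.single i 1, fun j hj => Pi.single_eq_of_ne (fun e : j = i => hj (by rwa [e])) _, ?_⟩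
      rw [prod_ofFn_eq_of_unique _ i fun j hj => by simp [Pi.single_eq_of_ne hj]]
      simp
    · intro g hg
      exact ⟨0, by simp, by simpa using hg⟩
  obtain ⟨β, h1, h2⟩ := hT hg
  exact ⟨β, h1, by rwa [← QuotientGroup.eq]⟩

end Products

/-! ### Invariants of Nielsen transformations. -/

section NielsenBasic

variable {G : Type*} [Group G]

theorem NielsenStep.length_eq {l l' : List G} (h : NielsenStep l l') : l'.length = l.length := by
  cases h <;> simp

theorem NielsenStep.closure_eq {l l' : List G} (h : NielsenStep l l') :
    Subgroup.closure {g | g ∈ l'} = Subgroup.closure {g | g ∈ l} := by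
  have hm : ∀ {l : List G} {g : G}, g ∈ l → g ∈ Subgroup.closure {g | g ∈ l} :=
    fun h => Subgroup.subset_closure h
  apply le_antisymm <;> rw [Subgroup.closure_le]
  · intro g hg
    cases h with
    | swap i j =>
      rcases List.mem_or_eq_of_mem_set hg with hg | rfl
      · rcases List.mem_or_eq_of_mem_set hg with hg | rfl
        · exact hm hg
        · exact hm (List.getElem_mem _)
      · exact hm (List.getElem_mem _)
    | inv i =>
      rcases List.mem_or_eq_of_mem_set hg with hg | rfl
      · exact hm hg
      · exact inv_mem (hm (List.getElem_mem _))
    | mul i j h =>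
      rcases List.mem_or_eq_of_mem_set hg with hg | rfl
      · exact hm hg
      · exact mul_mem (hm (List.getElem_mem _)) (hm (List.getElem_mem _))
  · intro g hg
    obtain ⟨n, hn, rfl⟩ := List.getElem_of_mem hg
    have key : ∀ (n : ℕ) (hn : n < l'.length), l'[n] ∈ Subgroup.closure {g | g ∈ l'} :=
      fun n hn => hm (List.getElem_mem _)
    cases h with
    | swap i j =>
      by_cases hj : n = j
      · subst hj
        have := key i (by simp)
        by_cases hij : (i : ℕ) = j
        · simpa [List.getElem_set, hij] using this
        · simpa [List.getElem_set, hij, Ne.symm hij] using this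
      · by_cases hi : n = i
        · subst hi
          have := key j (by simp)
          simpa [List.getElem_set] using this
        · have := key n (by simpa)
          simpa [List.getElem_set, Ne.symm hi, Ne.symm hj] using this
    | inv i =>
      have := key n (by simpa)
      by_cases hi : n = i
      · subst hi
        simpa [List.getElem_set] using this
      · simpa [List.getElem_set, Ne.symm hi] using this
    | mul i j h =>
      have h1 := key n (by simpa)
      by_cases hi : n = i
      · subst hi
        have hij : (i : ℕ) ≠ j := fun e => h (Fin.ext e)
        have h2 := key j (by simp)
        have := mul_mem h1 (inv_mem h2)
        simpa [List.getElem_set, hij] using this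
      · simpa [List.getElem_set, Ne.symm hi] using h1

theorem Nielsen.length_eq {l l' : List G} (h : Nielsen l l') : l'.length = l.length := by
  induction h with
  | refl => rfl
  | tail _ h ih => rw [h.length_eq, ih]

theorem Nielsen.closure_eq {l l' : List G} (h : Nielsen l l') :
    Subgroup.closure {g | g ∈ l'} = Subgroup.closure {g | g ∈ l} := by
  induction h with
  | refl => rfl
  | tail _ h ih => rw [h.closure_eq, ih]

end NielsenBasic

/-! ### The filtration of the units of a power series ring. -/

section Magnus

variable {A : Type*} [Ring A]

/-- The units `1 + a X`. -/
noncomputable def oneAddUnit (a : A) : (A⟦X⟧)ˣ where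
  val := 1 + PowerSeries.C a * PowerSeries.X
  inv := PowerSeries.mk fun n => (-a) ^ n
  val_inv := by
    ext n
    rw [add_mul, one_mul, mul_assoc, map_add, PowerSeries.coeff_C_mul]
    cases n with
    | zero => simp
    | succ n => simp [PowerSeries.coeff_succ_X_mul, pow_succ']
  inv_val := by
    ext n
    rw [mul_add, mul_one, ← PowerSeries.X_mul, ← mul_assoc, map_add, PowerSeries.coeff_mul_C]
    cases n with
    | zero => simp
    | succ n => simp [PowerSeries.coeff_succ_mul_X, pow_succ]

/-- The units congruent to `1` modulo `X ^ n`. -/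
def unitFiltration (A : Type*) [Ring A] (n : ℕ) : Subgroup (A⟦X⟧)ˣ where
  carrier := {u | (PowerSeries.X : A⟦X⟧) ^ n ∣ (u : A⟦X⟧) - 1}
  one_mem' := by simp
  mul_mem' := by
    rintro u v hu hv
    have : ((u * v : (A⟦X⟧)ˣ) : A⟦X⟧) - 1 = ((u : A⟦X⟧) - 1) * v + (v - 1) := by
      push_cast; noncomm_ring
    change _ ∣ ((u * v : (A⟦X⟧)ˣ) : A⟦X⟧) - 1
    rw [this]
    exact dvd_add (dvd_mul_of_dvd_left hu _) hv
  inv_mem' := by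
    rintro u hu
    have : ((u⁻¹ : (A⟦X⟧)ˣ) : A⟦X⟧) - 1 = -(((u : A⟦X⟧) - 1) * (u⁻¹ : (A⟦X⟧)ˣ)) := by
      rw [sub_mul, Units.mul_inv]; noncomm_ring
    change _ ∣ ((u⁻¹ : (A⟦X⟧)ˣ) : A⟦X⟧) - 1
    rw [this]
    exact (dvd_mul_of_dvd_left hu _).neg_right

theorem exists_of_mem_unitFiltration {n : ℕ} {u : (A⟦X⟧)ˣ} (hu : u ∈ unitFiltration A n) :
    ∃ a : A⟦X⟧, (u : A⟦X⟧) = 1 + PowerSeries.X ^ n * a := by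
  obtain ⟨a, ha⟩ := hu
  exact ⟨a, by rw [← ha]; noncomm_ring⟩

theorem coeff_one_add_X_pow_mul {n : ℕ} (hn : 1 ≤ n) (a : A⟦X⟧) :
    PowerSeries.coeff n (1 + PowerSeries.X ^ n * a) = PowerSeries.coeff 0 a := by
  have := PowerSeries.coeff_X_pow_mul a n 0
  rw [zero_add] at this
  rw [map_add, this, PowerSeries.coeff_one, if_neg (by omega), zero_add]

theorem constCoeff_of_mem {n : ℕ} (hn : 1 ≤ n) {u : (A⟦X⟧)ˣ} (hu : u ∈ unitFiltration A n) :
    PowerSeries.constantCoeff (u : A⟦X⟧) = 1 := by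
  obtain ⟨a, ha⟩ := exists_of_mem_unitFiltration hu
  rw [ha]
  simp [show n ≠ 0 by omega]

theorem coeff_mul_of_mem {n : ℕ} (hn : 1 ≤ n) {u v : (A⟦X⟧)ˣ} (hu : u ∈ unitFiltration A n)
    (hv : v ∈ unitFiltration A n) :
    PowerSeries.coeff n ((u * v : (A⟦X⟧)ˣ) : A⟦X⟧) =
      PowerSeries.coeff n (u : A⟦X⟧) + PowerSeries.coeff n (v : A⟦X⟧) := by
  obtain ⟨a, ha⟩ := exists_of_mem_unitFiltration hu
  obtain ⟨b, hb⟩ := exists_of_mem_unitFiltration hv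
  rw [Units.val_mul, ha, hb, coeff_one_add_X_pow_mul hn, coeff_one_add_X_pow_mul hn]
  rw [show (1 + PowerSeries.X ^ n * a) * (1 + PowerSeries.X ^ n * b) =
    1 + PowerSeries.X ^ n * (a + b + a * (PowerSeries.X ^ n * b)) by noncomm_ring,
    coeff_one_add_X_pow_mul hn, ← mul_assoc, ← PowerSeries.X_pow_mul, mul_assoc]
  simp [show n ≠ 0 by omega]

/-- `[u, v] = 1 + u⁻¹v⁻¹ (uv - vu)`, and in `uv - vu` only the bracket of the two tails survives
because `X` is central. -/
theorem coe_gcomm_of_mem {p q : ℕ} {u v : (A⟦X⟧)ˣ} {a b : A⟦X⟧}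
    (ha : (u : A⟦X⟧) = 1 + PowerSeries.X ^ p * a) (hb : (v : A⟦X⟧) = 1 + PowerSeries.X ^ q * b) :
    ((gcomm u v : (A⟦X⟧)ˣ) : A⟦X⟧) = 1 + PowerSeries.X ^ (p + q) *
      (((u⁻¹ * v⁻¹ : (A⟦X⟧)ˣ) : A⟦X⟧) * (a * b - b * a)) := by
  have h1 : (u : A⟦X⟧) * (v : A⟦X⟧) - (v : A⟦X⟧) * (u : A⟦X⟧) = PowerSeries.X ^ (p + q) * (a * b - b * a) := by
    have e1 : PowerSeries.X ^ p * a * (PowerSeries.X ^ q * b) =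
        PowerSeries.X ^ (p + q) * (a * b) := by
      rw [mul_assoc, ← mul_assoc a, ← PowerSeries.X_pow_mul, mul_assoc, pow_add, mul_assoc]
    have e2 : PowerSeries.X ^ q * b * (PowerSeries.X ^ p * a) =
        PowerSeries.X ^ (p + q) * (b * a) := by
      rw [mul_assoc, ← mul_assoc b, ← PowerSeries.X_pow_mul, mul_assoc, add_comm p q, pow_add,
        mul_assoc]
    rw [ha, hb, mul_sub, ← e1, ← e2]
    noncomm_ring
  have h2 : (gcomm u v : (A⟦X⟧)ˣ) = (u⁻¹ * v⁻¹) * (u * v) := by simp [gcomm, mul_assoc]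
  have h3 : ((u⁻¹ * v⁻¹ : (A⟦X⟧)ˣ) : A⟦X⟧) * (v * u) = 1 := by
    rw [← Units.val_mul, ← Units.val_mul]; simp [mul_assoc]
  rw [h2, Units.val_mul, ← mul_assoc, PowerSeries.X_pow_mul, mul_assoc, ← h1,
    mul_sub, h3, Units.val_mul]
  noncomm_ring

theorem gcomm_mem_unitFiltration {p q : ℕ} {u v : (A⟦X⟧)ˣ} (hu : u ∈ unitFiltration A p)
    (hv : v ∈ unitFiltration A q) : gcomm u v ∈ unitFiltration A (p + q) := by
  obtain ⟨a, ha⟩ := exists_of_mem_unitFiltration hu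
  obtain ⟨b, hb⟩ := exists_of_mem_unitFiltration hv
  exact ⟨_, sub_eq_of_eq_add' (coe_gcomm_of_mem ha hb)⟩

/-- The unit `u⁻¹ v⁻¹` has constant term `1`, so in lowest degree group commutators become Lie
brackets. -/
theorem coeff_gcomm {p q : ℕ} (hp : 1 ≤ p) (hq : 1 ≤ q) {u v : (A⟦X⟧)ˣ}
    (hu : u ∈ unitFiltration A p) (hv : v ∈ unitFiltration A q) :
    PowerSeries.coeff (p + q) ((gcomm u v : (A⟦X⟧)ˣ) : A⟦X⟧) =
      PowerSeries.coeff p (u : A⟦X⟧) * PowerSeries.coeff q (v : A⟦X⟧) -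
        PowerSeries.coeff q (v : A⟦X⟧) * PowerSeries.coeff p (u : A⟦X⟧) := by
  have hc : PowerSeries.constantCoeff ((u⁻¹ * v⁻¹ : (A⟦X⟧)ˣ) : A⟦X⟧) = 1 := by
    rw [Units.val_mul, map_mul, constCoeff_of_mem hp (inv_mem hu),
      constCoeff_of_mem hq (inv_mem hv), one_mul]
  obtain ⟨a, ha⟩ := exists_of_mem_unitFiltration hu
  obtain ⟨b, hb⟩ := exists_of_mem_unitFiltration hv
  rw [coe_gcomm_of_mem ha hb, coeff_one_add_X_pow_mul (by omega),
    PowerSeries.coeff_zero_eq_constantCoeff_apply, map_mul, hc, ha, hb,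
    coeff_one_add_X_pow_mul hp, coeff_one_add_X_pow_mul hq]
  simp

end Magnus

/-! ### Leading coefficients of the Magnus expansion. -/

section LeadingCoefficients

variable {k : ℕ}

/-- The Magnus homomorphism, with the degree recorded by a central variable. -/
noncomputable def magnus (k : ℕ) : FreeGroup (Fin k) →* ((FreeAlgebra ℤ (Fin k))⟦X⟧)ˣ :=
  FreeGroup.lift fun i => oneAddUnit (FreeAlgebra.ι ℤ i)

/-- The homogeneous component of degree `n` of the image under the Magnus homomorphism. -/
noncomputable def lead (n : ℕ) (g : FreeGroup (Fin k)) : FreeAlgebra ℤ (Fin k) :=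
  PowerSeries.coeff n (magnus k g : (FreeAlgebra ℤ (Fin k))⟦X⟧)

theorem magnus_mem_one (g : FreeGroup (Fin k)) : magnus k g ∈ unitFiltration _ 1 := by
  suffices h : (unitFiltration (FreeAlgebra ℤ (Fin k)) 1).comap (magnus k) = ⊤ by
    have : g ∈ (unitFiltration (FreeAlgebra ℤ (Fin k)) 1).comap (magnus k) := by
      rw [h]; trivial
    exact this
  apply eq_top_of_of_mem
  intro i
  refine ⟨PowerSeries.C (FreeAlgebra.ι ℤ i), ?_⟩
  rw [magnus, FreeGroup.lift_apply_of, pow_one, PowerSeries.X_mul]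
  exact add_sub_cancel_left _ _

theorem magnus_mem {n : ℕ} (hn : 1 ≤ n) {g : FreeGroup (Fin k)} (hg : g ∈ lcs _ n) :
    magnus k g ∈ unitFiltration _ n := by
  suffices h : lcs _ n ≤ (unitFiltration (FreeAlgebra ℤ (Fin k)) n).comap (magnus k) from h hg
  clear hg g
  induction n, hn using Nat.le_induction with
  | base => exact fun g _ => magnus_mem_one g
  | succ n hn ih =>
    rw [lcs_succ hn, Subgroup.commutator_le]
    intro g hg h _
    rw [← inv_inv g, ← inv_inv h, ← gcomm_eq, Subgroup.mem_comap, map_gcomm]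
    exact gcomm_mem_unitFiltration (ih (inv_mem hg)) (magnus_mem_one _)

variable {n : ℕ}

/-- With `lead_eq_zero`, this makes `lead n` an additive invariant of `lcs n` modulo `lcs (n + 1)`,
so congruences between group elements turn into linear algebra. -/
theorem lead_mul (hn : 1 ≤ n) {g h : FreeGroup (Fin k)} (hg : g ∈ lcs _ n) (hh : h ∈ lcs _ n) :
    lead n (g * h) = lead n g + lead n h := by
  rw [lead, map_mul, coeff_mul_of_mem hn (magnus_mem hn hg) (magnus_mem hn hh)]
  rfl

theorem lead_one (hn : 1 ≤ n) : lead n (1 : FreeGroup (Fin k)) = 0 := by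
  have := lead_mul hn (one_mem (lcs (FreeGroup (Fin k)) n)) (one_mem _)
  simpa using this

theorem lead_inv (hn : 1 ≤ n) {g : FreeGroup (Fin k)} (hg : g ∈ lcs _ n) :
    lead n g⁻¹ = -lead n g := by
  have := lead_mul hn hg (inv_mem hg)
  rw [mul_inv_cancel, lead_one hn] at this
  exact (neg_eq_of_add_eq_zero_right this.symm).symm

theorem lead_pow (hn : 1 ≤ n) {g : FreeGroup (Fin k)} (hg : g ∈ lcs _ n) (m : ℕ) :
    lead n (g ^ m) = m • lead n g := by
  induction m with
  | zero => simp [lead_one hn]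
  | succ m ih => rw [pow_succ, lead_mul hn (pow_mem hg m) hg, ih, succ_nsmul]

theorem lead_zpow (hn : 1 ≤ n) {g : FreeGroup (Fin k)} (hg : g ∈ lcs _ n) (m : ℤ) :
    lead n (g ^ m) = m • lead n g := by
  cases m with
  | ofNat m => simp [lead_pow hn hg]
  | negSucc m =>
    rw [zpow_negSucc, lead_inv hn (pow_mem hg _), lead_pow hn hg, negSucc_zsmul]

theorem lead_eq_zero (hn : 1 ≤ n) {g : FreeGroup (Fin k)} (hg : g ∈ lcs _ (n + 1)) :
    lead n g = 0 := by
  obtain ⟨a, ha⟩ := exists_of_mem_unitFiltration (magnus_mem (by omega) hg)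
  rw [lead, ha, pow_succ, mul_assoc, coeff_one_add_X_pow_mul hn]
  simp

theorem lead_prod_ofFn (hn : 1 ≤ n) {m : ℕ} (f : Fin m → FreeGroup (Fin k))
    (hf : ∀ i, f i ∈ lcs _ n) : lead n (List.ofFn f).prod = ∑ i, lead n (f i) := by
  induction m with
  | zero => simp [lead_one hn]
  | succ m ih =>
    rw [List.ofFn_succ, List.prod_cons, lead_mul hn (hf 0), ih _ fun i => hf i.succ,
      Fin.sum_univ_succ]
    apply Subgroup.list_prod_mem
    intro x hx
    rw [List.mem_ofFn] at hx
    obtain ⟨i, rfl⟩ := hx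
    exact hf _

theorem lead_eval (t : FreeMagma (Fin k)) : lead t.length (eval t) = liePoly ℤ t := by
  induction t with
  | ih1 i =>
    change PowerSeries.coeff 1 (magnus k (FreeGroup.of i) : (FreeAlgebra ℤ (Fin k))⟦X⟧) =
      FreeAlgebra.ι ℤ i
    rw [magnus, FreeGroup.lift_apply_of]
    change PowerSeries.coeff 1 (1 + PowerSeries.C _ * PowerSeries.X) = _
    simp [PowerSeries.coeff_one]
  | ih2 b c hb hc =>
    change PowerSeries.coeff (b.length + c.length)
      (magnus k (gcomm (eval b) (eval c)) : (FreeAlgebra ℤ (Fin k))⟦X⟧) = 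
      liePoly ℤ b * liePoly ℤ c - liePoly ℤ c * liePoly ℤ b
    rw [map_gcomm, coeff_gcomm b.length_pos c.length_pos
      (magnus_mem b.length_pos (eval_mem_lcs b)) (magnus_mem c.length_pos (eval_mem_lcs c)),
      ← hb, ← hc]
    rfl

theorem lead_mem_span (hn : 1 ≤ n) {s : Set (FreeGroup (Fin k))} (hs : s ⊆ (lcs (FreeGroup (Fin k)) n : Set _))
    {g : FreeGroup (Fin k)} (hg : g ∈ Subgroup.closure s) :
    lead n g ∈ Submodule.span ℤ (lead n '' s) := by
  suffices h : g ∈ lcs _ n ∧ lead n g ∈ Submodule.span ℤ (lead n '' s) from h.2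
  induction hg using Subgroup.closure_induction with
  | mem x hx => exact ⟨hs hx, Submodule.subset_span ⟨x, hx, rfl⟩⟩
  | one => exact ⟨one_mem _, by rw [lead_one hn]; exact zero_mem _⟩
  | mul x y _ _ hx hy =>
    exact ⟨mul_mem hx.1 hy.1, by rw [lead_mul hn hx.1 hy.1]; exact add_mem hx.2 hy.2⟩
  | inv x _ hx => exact ⟨inv_mem hx.1, by rw [lead_inv hn hx.1]; exact neg_mem hx.2⟩

end LeadingCoefficients

/-! ### Bases of the lower central quotients. -/

section LcsBasis

variable {k : ℕ}

/-- `b` is a basis of `lcs w` modulo `lcs (w + 1)`. -/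
structure IsLcsBasis (w : ℕ) (b : List (FreeGroup (Fin k))) : Prop where
  mem : ∀ g ∈ b, g ∈ lcs _ w
  span : lcs _ w ≤ Subgroup.closure {g | g ∈ b} ⊔ lcs _ (w + 1)
  indep : LinearIndependent ℤ fun i : Fin b.length => lead w (b.get i)

theorem IsBasicList.isLcsBasis {lt : FreeMagma (Fin k) → FreeMagma (Fin k) → Prop}
    (hlt : IsCommutatorOrder lt) {w : ℕ} (hw : 1 ≤ w) {B : List (FreeGroup (Fin k))}
    (hB : IsBasicList lt w B) : IsLcsBasis w B := by
  obtain ⟨T, hT, hmem, rfl⟩ := hB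
  refine ⟨?_, ?_, ?_⟩
  · intro g hg
    obtain ⟨t, ht, rfl⟩ := List.mem_map.1 hg
    rw [← ((hmem t).1 ht).2]
    exact eval_mem_lcs t
  · refine (lcs_le_basicSpan hlt hw).trans (sup_le_sup_right (Subgroup.closure_mono ?_) _)
    rintro _ ⟨t, ht, rfl⟩
    exact List.mem_map.2 ⟨t, (hmem t).2 ht, rfl⟩
  · have hm : ∀ i : Fin (T.map eval).length, T[i]'(by simpa using i.2) ∈ T :=
      fun i => List.getElem_mem _
    have := (linearIndependent_liePoly ℤ hlt w).comp
      (fun i : Fin (T.map eval).length => ⟨T[i]'(by simpa using i.2), (hmem _).1 (hm i)⟩)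
      fun i j hij => Fin.ext ((List.Nodup.getElem_inj_iff hT).1 (congrArg Subtype.val hij))
    convert this using 2 with i
    · rw [Function.comp_apply, ← lead_eval]
      change _ = lead (FreeMagma.length (T[i]'(by simpa using i.2))) (eval T[i])
      rw [((hmem _).1 (hm i)).2]
      simp
    · rfl
    · exact Subsingleton.elim _ _

theorem exists_isBasicList (lt : FreeMagma (Fin k) → FreeMagma (Fin k) → Prop) (w : ℕ) :
    ∃ B, IsBasicList lt w B := by
  have hfin : {t : FreeMagma (Fin k) | IsBasic lt t ∧ t.length = w}.Finite :=
    (finite_length_le k w).subset fun t ht => ht.2.le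
  exact ⟨_, hfin.toFinset.toList, Finset.nodup_toList _, fun t => by simp, rfl⟩

namespace IsLcsBasis

variable {w : ℕ} {b : List (FreeGroup (Fin k))}

/-- A Nielsen transformation preserves the length of the tuple and the span of its leads, and
independence over `ℤ` means that the length equals the rank of that span. -/
theorem of_nielsen (hw : 1 ≤ w) (hb : IsLcsBasis w b) {b' : List (FreeGroup (Fin k))}
    (h : Nielsen b b') : IsLcsBasis w b' := by
  have hle : Subgroup.closure {g | g ∈ b'} ≤ lcs _ w := by
    rw [h.closure_eq, Subgroup.closure_le]
    exact hb.mem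
  have hmem : ∀ g ∈ b', g ∈ lcs _ w := fun g hg => hle (Subgroup.subset_closure hg)
  refine ⟨hmem, by rw [h.closure_eq]; exact hb.span, ?_⟩
  have hr : ∀ l : List (FreeGroup (Fin k)),
      Set.range (fun i : Fin l.length => lead w (l.get i)) = lead w '' {g | g ∈ l} := by
    intro l
    ext v
    constructor
    · rintro ⟨i, rfl⟩
      exact ⟨_, List.getElem_mem _, rfl⟩
    · rintro ⟨g, hg, rfl⟩
      obtain ⟨i, hi, rfl⟩ := List.getElem_of_mem hg
      exact ⟨⟨i, hi⟩, rfl⟩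
  have hspan : Submodule.span ℤ (lead w '' {g | g ∈ b'}) =
      Submodule.span ℤ (lead w '' {g | g ∈ b}) := by
    apply le_antisymm <;> rw [Submodule.span_le]
    · rintro _ ⟨g, hg, rfl⟩
      exact lead_mem_span hw hb.mem (h.closure_eq ▸ Subgroup.subset_closure hg)
    · rintro _ ⟨g, hg, rfl⟩
      exact lead_mem_span hw hmem (h.closure_eq ▸ Subgroup.subset_closure hg)
  have h1 := linearIndependent_iff_card_eq_finrank_span.1 hb.indep
  rw [linearIndependent_iff_card_eq_finrank_span, Set.finrank, hr, hspan, ← hr, ← Set.finrank,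
    ← h1]
  simp [h.length_eq]

theorem exists_prod (hw : 1 ≤ w) (hb : IsLcsBasis w b) {g : FreeGroup (Fin k)}
    (hg : g ∈ lcs _ w) : ∃ c : Fin b.length → ℤ,
      g⁻¹ * (List.ofFn fun i : Fin b.length => b.get i ^ c i).prod ∈ lcs _ (w + 1) ∧
      lead w g = ∑ i : Fin b.length, c i • lead w (b.get i) := by
  have hmem : ∀ i : Fin b.length, b.get i ∈ lcs _ w := fun i => hb.mem _ (List.getElem_mem _)
  obtain ⟨c, -, hc⟩ := exists_prod_zpow (N := lcs _ (w + 1)) (fun i : Fin b.length => b.get i)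
    Set.univ (fun i _ g => lcs_succ_le_centMod hw le_rfl g (hmem i)) (g := g) (by
      refine (hb.span.trans (sup_le_sup_right (Subgroup.closure_mono ?_) _)) hg
      intro x hx
      obtain ⟨i, hi, rfl⟩ := List.getElem_of_mem hx
      exact ⟨⟨i, hi⟩, trivial, rfl⟩)
  refine ⟨c, hc, ?_⟩
  have h1 : (List.ofFn fun i : Fin b.length => b.get i ^ c i).prod ∈ lcs _ w :=
    (Subgroup.mul_mem_cancel_left _ (inv_mem hg)).1 (lcs_antitone (Nat.le_succ w) hc)
  have h2 := lead_eq_zero hw hc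
  rw [lead_mul hw (inv_mem hg) h1, lead_inv hw hg, neg_add_eq_zero,
    lead_prod_ofFn hw _ fun i => zpow_mem (hmem i) _] at h2
  rw [h2]
  exact Finset.sum_congr rfl fun i _ => lead_zpow hw (hmem i) _

/-- Modulo `lcs (w + 1)` the element is a product of powers of the basis, and independence of the
leads forces all exponents to vanish. Diagonal form can thus be checked on leads alone. -/
theorem mem_of_lead_eq_zero (hw : 1 ≤ w) (hb : IsLcsBasis w b) {g : FreeGroup (Fin k)}
    (hg : g ∈ lcs _ w) (h : lead w g = 0) : g ∈ lcs _ (w + 1) := by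
  obtain ⟨c, hc, h1⟩ := hb.exists_prod hw hg
  have h2 := Fintype.linearIndependent_iff.1 hb.indep c (by rw [← h1, h])
  have h3 : g⁻¹ ∈ lcs _ (w + 1) := by simpa [h2] using hc
  exact inv_mem_iff.1 h3

end IsLcsBasis

end LcsBasis

/-! ### Existence and uniqueness of exponents along a filtration. -/

section Exponents

variable {k : ℕ}

/-- The error left after treating weights up to `w` lies in `K (w + 1)`. Modulo `K (w + 2)` it is a
product of powers of the `r i` of weight `w + 1`. These are central there, so their exponents are
simply added to the earlier ones. -/
theorem exists_exponents {G : Type*} [Group G] {t n : ℕ} (r : Fin t → G) (wt : Fin t → ℕ)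
    (K : ℕ → Subgroup G) [∀ w, (K w).Normal]
    (hK : ∀ w, 1 ≤ w → w ≤ n → K w ≤ Subgroup.closure (r '' {i | wt i = w}) ⊔ K (w + 1))
    (hcent : ∀ i g, r i ∈ centMod (K (wt i + 1)) g) {g : G} (hg : g ∈ K 1) :
    ∃ α : Fin t → ℤ, g⁻¹ * (List.ofFn fun i => r i ^ α i).prod ∈ K (n + 1) := by
  suffices h : ∀ w ≤ n, ∃ α : Fin t → ℤ, g⁻¹ * (List.ofFn fun i => r i ^ α i).prod ∈ K (w + 1) from
    h n le_rfl
  intro w hw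
  induction w with
  | zero => exact ⟨0, by simpa using hg⟩
  | succ w ih =>
    obtain ⟨α, hα⟩ := ih (by omega)
    set P := (List.ofFn fun i => r i ^ α i).prod with hP
    have hc : ∀ i ∈ {i | wt i = w + 1}, ∀ g, r i ∈ centMod (K (w + 1 + 1)) g := by
      intro i hi g
      have := hcent i g
      rwa [show wt i = w + 1 from hi] at this
    obtain ⟨β, hβ, hβ'⟩ := exists_prod_zpow r _ hc (hK (w + 1) (by omega) hw (inv_mem hα))
    set Q := (List.ofFn fun i => r i ^ β i).prod with hQ
    refine ⟨α + β, ?_⟩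
    have h1 := prod_ofFn_mul_mod (N := K (w + 1 + 1)) (fun i => r i ^ α i) (fun i => r i ^ β i)
      fun i g => by
        by_cases hi : wt i = w + 1
        · exact zpow_mem (hc i hi g) _
        · rw [hβ i hi, zpow_zero]; exact one_mem _
    rw [← hP, ← hQ] at h1
    simp only [Pi.add_apply, zpow_add]
    have h2 := mul_mem hβ' h1
    rwa [inv_inv, mul_assoc, mul_assoc, mul_inv_rev, mul_assoc, mul_inv_cancel_left,
      mul_inv_cancel_left] at h2

/-- Once the exponents agree up to weight `w`, the powers `r i ^ (β i - α i)` all lie in `lcs (w +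
1)` and their product lies in `lcs (w + 2)`. Taking leads removes the heavier factors and leaves a
linear relation in weight `w + 1`. -/
theorem exponents_unique {t n : ℕ} (r : Fin t → FreeGroup (Fin k)) (wt : Fin t → ℕ)
    (hr : ∀ i, r i ∈ lcs _ (wt i)) (hwt : ∀ i, 1 ≤ wt i ∧ wt i ≤ n)
    (hind : ∀ w, 1 ≤ w → w ≤ n → LinearIndepOn ℤ (fun i => lead w (r i)) {i | wt i = w})
    {α β : Fin t → ℤ} (h : (List.ofFn fun i => r i ^ α i).prod⁻¹ *
      (List.ofFn fun i => r i ^ β i).prod ∈ lcs _ (n + 1)) : α = β := by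
  suffices hw : ∀ w ≤ n, ∀ i, wt i ≤ w → α i = β i from
    funext fun i => hw n le_rfl i (hwt i).2
  intro w hw
  induction w with
  | zero => intro i hi; have := (hwt i).1; omega
  | succ w ih =>
    have ih := ih (by omega)
    set δ : Fin t → ℤ := β - α with hδ
    have h0 : ∀ i, wt i ≤ w → δ i = 0 := fun i hi => by simp [hδ, ih i hi]
    have hm : ∀ i, r i ^ δ i ∈ lcs _ (w + 1) := by
      intro i
      by_cases hi : wt i ≤ w
      · rw [h0 i hi, zpow_zero]; exact one_mem _
      · exact zpow_mem (lcs_antitone (by omega) (hr i)) _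
    have h1 := prod_ofFn_mul_mod (N := lcs _ (w + 1 + 1)) (fun i => r i ^ α i)
      (fun i => r i ^ δ i) fun i g => lcs_succ_le_centMod (by omega) le_rfl g (hm i)
    have h2 : (fun i => r i ^ α i * r i ^ δ i) = fun i => r i ^ β i := by
      funext i
      rw [← zpow_add, hδ, Pi.sub_apply, add_sub_cancel]
    rw [h2] at h1
    have h3 : (List.ofFn fun i => r i ^ δ i).prod ∈ lcs _ (w + 1 + 1) := by
      have := mul_mem (lcs_antitone (show w + 1 + 1 ≤ n + 1 by omega) h) (inv_mem h1)
      simpa [mul_assoc] using this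
    have h4 := lead_eq_zero (by omega) h3
    rw [lead_prod_ofFn (by omega) _ hm] at h4
    have h5 := hind (w + 1) (by omega) hw
    rw [show {i | wt i = w + 1} = ((Finset.univ.filter fun i => wt i = w + 1 : Finset (Fin t)) :
      Set (Fin t)) by ext; simp, linearIndepOn_finset_iff] at h5
    have h6 := h5 δ (by
      rw [← h4, Finset.sum_filter]
      refine Finset.sum_congr rfl fun i _ => ?_
      split_ifs with hi
      · rw [lead_zpow (by omega)]
        rw [← hi]
        exact hr i
      · symm
        by_cases hi' : wt i ≤ w
        · rw [h0 i hi', zpow_zero, lead_one (by omega)]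
        · exact lead_eq_zero (by omega) (zpow_mem (lcs_antitone (by omega) (hr i)) _))
    intro i hi
    rcases Nat.lt_succ_iff_lt_or_eq.1 (Nat.lt_succ_of_le hi) with hi | hi
    · exact ih i (by omega)
    · have := h6 i (by simpa using hi)
      rw [hδ, Pi.sub_apply] at this
      omega

end Exponents

/-! ### The filtration of the normal closure of the relators. -/

section Filtration

variable {k : ℕ} {rel : List (FreeGroup (Fin k))} {x y : ℕ → List (FreeGroup (Fin k))}
  {s : ℕ → ℕ}

theorem mem_crossComm {p q : ℕ} {g : FreeGroup (Fin k)} (hg : g ∈ crossComm x y s p q) :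
    ∃ a ∈ rBasic y s p, ∃ b ∈ x q, g = gcomm a b ∨ g = gcomm b a := by
  obtain ⟨⟨a, i⟩, ha, hg⟩ := List.mem_flatMap.1 hg
  obtain ⟨⟨b, j⟩, hb, rfl⟩ := List.mem_map.1 hg
  refine ⟨a, List.fst_mem_of_mem_zipIdx ha, b, List.fst_mem_of_mem_zipIdx hb, ?_⟩
  split_ifs
  · exact Or.inl rfl
  · exact Or.inr rfl

theorem gcomm_mem_crossComm {p q : ℕ} {a b : FreeGroup (Fin k)} (ha : a ∈ rBasic y s p)
    (hb : b ∈ x q) : gcomm a b ∈ crossComm x y s p q ∨ gcomm b a ∈ crossComm x y s p q := by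
  obtain ⟨i, hi, rfl⟩ := List.getElem_of_mem ha
  obtain ⟨j, hj, rfl⟩ := List.getElem_of_mem hb
  have key : (if q < p ∨ (q = p ∧ j ≤ i) then gcomm (rBasic y s p)[i] (x q)[j]
      else gcomm (x q)[j] (rBasic y s p)[i]) ∈ crossComm x y s p q :=
    List.mem_flatMap.2 ⟨((rBasic y s p)[i], i), by simp [List.mk_mem_zipIdx_iff_getElem?],
      List.mem_map.2 ⟨((x q)[j], j), by simp [List.mk_mem_zipIdx_iff_getElem?], rfl⟩⟩
  split_ifs at key
  · exact Or.inl key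
  · exact Or.inr key

theorem mem_stageGens_succ {w : ℕ} (hw : 1 ≤ w) {g : FreeGroup (Fin k)} :
    g ∈ stageGens rel x y s (w + 1) ↔ g ∈ (y w).drop (s w) ∨
      ∃ p q, 1 ≤ p ∧ 1 ≤ q ∧ p + q = w + 1 ∧ g ∈ crossComm x y s p q := by
  obtain ⟨v, rfl⟩ := Nat.exists_eq_add_of_le' hw
  rw [stageGens, List.mem_append, List.mem_flatMap]
  refine or_congr_right ⟨?_, ?_⟩
  · rintro ⟨⟨p, q⟩, hpq, h⟩
    rw [List.Nat.mem_antidiagonal] at hpq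
    exact ⟨p + 1, q + 1, by omega, by omega, by simp at hpq; omega, h⟩
  · rintro ⟨p, q, hp, hq, hpq, h⟩
    refine ⟨(p - 1, q - 1), ?_, ?_⟩
    · rw [List.Nat.mem_antidiagonal]; simp; omega
    · simpa [Nat.sub_add_cancel hp, Nat.sub_add_cancel hq] using h

/-- Normal generators of the intersection of the normal closure of the relators with `lcs w`. -/
def relGens (rel : List (FreeGroup (Fin k))) (x y : ℕ → List (FreeGroup (Fin k))) (s : ℕ → ℕ)
    (w : ℕ) : Set (FreeGroup (Fin k)) :=
  {g | g ∈ stageGens rel x y s w} ∪ {g | ∃ p q, 1 ≤ p ∧ p < w ∧ 1 ≤ q ∧ w ≤ p + q ∧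
    ∃ a ∈ rBasic y s p, ∃ c ∈ lcs _ q, g = gcomm a c}

/-- The filtration of the normal closure of the relators that the construction produces. -/
def relFil (rel : List (FreeGroup (Fin k))) (x y : ℕ → List (FreeGroup (Fin k))) (s : ℕ → ℕ)
    (w : ℕ) : Subgroup (FreeGroup (Fin k)) :=
  Subgroup.normalClosure (relGens rel x y s w)

instance relFil_normal (w : ℕ) : (relFil rel x y s w).Normal := Subgroup.normalClosure_normal

theorem relFil_one : relFil rel x y s 1 = Subgroup.normalClosure {g | g ∈ rel} := by
  have : relGens rel x y s 1 = {g | g ∈ rel} := by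
    ext g
    refine ⟨?_, Or.inl⟩
    rintro (h | ⟨p, q, h1, h2, -⟩)
    · exact h
    · omega
  rw [relFil, this]

theorem gcomm_mem_relFil {w p q : ℕ} (hp : 1 ≤ p) (hpw : p < w) (hq : 1 ≤ q) (hw : w ≤ p + q)
    {a c : FreeGroup (Fin k)} (ha : a ∈ rBasic y s p) (hc : c ∈ lcs _ q) :
    gcomm a c ∈ relFil rel x y s w :=
  Subgroup.subset_normalClosure (Or.inr ⟨p, q, hp, hpw, hq, hw, a, ha, c, hc, rfl⟩)

theorem stageGens_mem_relFil {w : ℕ} {g : FreeGroup (Fin k)} (hg : g ∈ stageGens rel x y s w) :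
    g ∈ relFil rel x y s w :=
  Subgroup.subset_normalClosure (Or.inl hg)

theorem le_centMod {G : Type*} [Group G] (N : Subgroup G) [N.Normal] (c : G) :
    N ≤ centMod N c := fun g hg => by
  rw [mem_centMod, QuotientGroup.mk'_apply, (QuotientGroup.eq_one_iff g).2 hg]
  exact Commute.one_left _

theorem normal_of_central_mod {G : Type*} [Group G] {N L : Subgroup G} [N.Normal] (hN : N ≤ L)
    (h : ∀ l ∈ L, ∀ g, l ∈ centMod N g) : L.Normal where
  conj_mem n hn g := by
    have h1 : ⁅n, g⁆ ∈ L := hN (commutator_mem_iff.2 (h n hn g))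
    rw [show g * n * g⁻¹ = ⁅n, g⁆⁻¹ * n by simp [commutatorElement_def, mul_assoc]]
    exact L.mul_mem (inv_mem h1) hn

/-- This is the case `p = w`, `q = 1` of the commutators put into `relGens (w + 1)`. -/
theorem rBasic_central {w : ℕ} (hw : 1 ≤ w) {a : FreeGroup (Fin k)} (ha : a ∈ rBasic y s w)
    (g : FreeGroup (Fin k)) : a ∈ centMod (relFil rel x y s (w + 1)) g :=
  gcomm_mem_iff.1 (gcomm_mem_relFil hw (Nat.lt_succ_self w) le_rfl le_rfl ha (Subgroup.mem_top g))

theorem closure_le_closure_rBasic {w : ℕ} (hw : 1 ≤ w) :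
    Subgroup.closure {g | g ∈ y w} ≤
      Subgroup.closure {g | g ∈ rBasic y s w} ⊔ relFil rel x y s (w + 1) := by
  rw [Subgroup.closure_le]
  intro g hg
  change g ∈ y w at hg
  rw [← List.take_append_drop (s w) (y w), List.mem_append] at hg
  rcases hg with hg | hg
  · exact le_sup_left (a := Subgroup.closure _) (Subgroup.subset_closure hg)
  · exact le_sup_right (a := Subgroup.closure {g | g ∈ rBasic y s w})
      (stageGens_mem_relFil ((mem_stageGens_succ hw).2 (Or.inl hg)))

variable {lt : FreeMagma (Fin k) → FreeMagma (Fin k) → Prop} {d : ℕ → ℕ → ℕ} {n : ℕ}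

theorem IsStage.isLcsBasis (hlt : IsCommutatorOrder lt) {w : ℕ} (hw : 1 ≤ w)
    (h : IsStage rel x y s lt d w) : IsLcsBasis w (x w) := by
  obtain ⟨B, hB, hN⟩ := h.nielsen_x
  exact (hB.isLcsBasis hlt hw).of_nielsen hw hN

/-- The bound is `n + 1` because the starting tuple of weight `w` depends only on smaller weights;
the existence proof needs it there to begin the next step. -/
theorem stageGens_mem_lcs (hlt : IsCommutatorOrder lt)
    (hst : ∀ w, 1 ≤ w → w ≤ n → IsStage rel x y s lt d w) {w : ℕ} (hw : 1 ≤ w) (hwn : w ≤ n + 1) :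
    ∀ g ∈ stageGens rel x y s w, g ∈ lcs _ w := by
  induction w using Nat.strong_induction_on with
  | h w ih =>
  obtain rfl | hw2 := hw.eq_or_lt
  · exact fun g _ => Subgroup.mem_top g
  obtain ⟨v, rfl⟩ : ∃ v, w = v + 1 := ⟨w - 1, by omega⟩
  intro g hg
  rcases (mem_stageGens_succ (by omega)).1 hg with hg | ⟨p, q, hp, hq, hpq, hg⟩
  · obtain ⟨j, hj, rfl⟩ := List.getElem_of_mem hg
    rw [List.getElem_drop]
    exact (hst v (by omega) (by omega)).rest _ _ (Nat.le_add_right _ _)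
  · obtain ⟨a, ha, b, hb, hg⟩ := mem_crossComm hg
    have ha' : a ∈ lcs _ p := by
      have h1 : a ∈ Subgroup.closure {g | g ∈ y p} :=
        Subgroup.subset_closure (List.mem_of_mem_take ha)
      rw [(hst p hp (by omega)).nielsen_y.closure_eq] at h1
      exact (Subgroup.closure_le _).2 (ih p (by omega) hp (by omega)) h1
    have hb' : b ∈ lcs _ q := ((hst q hq (by omega)).isLcsBasis hlt hq).mem b hb
    rw [← hpq]
    rcases hg with rfl | rfl
    · exact gcomm_mem_lcs hp hq ha' hb'
    · rw [add_comm]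
      exact gcomm_mem_lcs hq hp hb' ha'

theorem mem_lcs_of_mem (hlt : IsCommutatorOrder lt)
    (hst : ∀ w, 1 ≤ w → w ≤ n → IsStage rel x y s lt d w) {w : ℕ} (hw : 1 ≤ w) (hwn : w ≤ n)
    {g : FreeGroup (Fin k)} (hg : g ∈ y w) : g ∈ lcs _ w := by
  have h1 : g ∈ Subgroup.closure {g | g ∈ y w} := Subgroup.subset_closure hg
  rw [(hst w hw hwn).nielsen_y.closure_eq] at h1
  exact (Subgroup.closure_le _).2 (stageGens_mem_lcs hlt hst hw (by omega)) h1

theorem relFil_le_lcs (hlt : IsCommutatorOrder lt)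
    (hst : ∀ w, 1 ≤ w → w ≤ n → IsStage rel x y s lt d w) {w : ℕ} (hw : 1 ≤ w) (hwn : w ≤ n + 1) :
    relFil rel x y s w ≤ lcs _ w := by
  refine Subgroup.normalClosure_le_normal ?_
  rintro g (hg | ⟨p, q, hp, hpw, hq, hpq, a, ha, c, hc, rfl⟩)
  · exact stageGens_mem_lcs hlt hst hw hwn g hg
  · exact lcs_antitone hpq (gcomm_mem_lcs hp hq
      (mem_lcs_of_mem hlt hst hp (by omega) (List.mem_of_mem_take ha)) hc)

theorem mem_relFil_of_mem {w : ℕ} (h : IsStage rel x y s lt d w) {g : FreeGroup (Fin k)}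
    (hg : g ∈ y w) : g ∈ relFil rel x y s w := by
  have h1 : g ∈ Subgroup.closure {g | g ∈ y w} := Subgroup.subset_closure hg
  rw [h.nielsen_y.closure_eq] at h1
  exact (Subgroup.closure_le _).2 (fun _ => stageGens_mem_relFil) h1

/-- The only commutators that are new at level `w + 1` are those with `p = w`, and for these the
entry `a` already lies in the normal subgroup `relFil w`. -/
theorem relFil_succ_le (hlt : IsCommutatorOrder lt)
    (hst : ∀ w, 1 ≤ w → w ≤ n → IsStage rel x y s lt d w) {w : ℕ} (hw : 1 ≤ w) (hwn : w ≤ n) :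
    relFil rel x y s (w + 1) ≤ relFil rel x y s w := by
  have hy : ∀ g ∈ y w, g ∈ relFil rel x y s w := fun g => mem_relFil_of_mem (hst w hw hwn)
  have key : ∀ p q, 1 ≤ p → p < w + 1 → 1 ≤ q → w + 1 ≤ p + q → ∀ a ∈ rBasic y s p,
      ∀ c ∈ lcs _ q, gcomm a c ∈ relFil rel x y s w := by
    intro p q hp hpw hq hpq a ha c hc
    rcases (Nat.le_of_lt_succ hpw).eq_or_lt with rfl | hpw
    · rw [gcomm_mem_iff]
      exact le_centMod _ _ (hy a (List.mem_of_mem_take ha))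
    · exact gcomm_mem_relFil hp hpw hq (by omega) ha hc
  refine Subgroup.normalClosure_le_normal ?_
  rintro g (hg | ⟨p, q, hp, hpw, hq, hpq, a, ha, c, hc, rfl⟩)
  · rcases (mem_stageGens_succ hw).1 hg with hg | ⟨p, q, hp, hq, hpq, hg⟩
    · exact hy g (List.mem_of_mem_drop hg)
    · obtain ⟨a, ha, b, hb, hg⟩ := mem_crossComm hg
      have h1 := key p q hp (by omega) hq hpq.ge a ha b
        (((hst q hq (by omega)).isLcsBasis hlt hq).mem b hb)
      rcases hg with rfl | rfl
      · exact h1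
      · rw [← gcomm_inv]
        exact inv_mem h1
  · exact key p q hp hpw hq hpq a ha c hc

theorem relFil_le_one (hlt : IsCommutatorOrder lt)
    (hst : ∀ w, 1 ≤ w → w ≤ n → IsStage rel x y s lt d w) {w : ℕ} (hw : w ≤ n) :
    relFil rel x y s (w + 1) ≤ relFil rel x y s 1 := by
  induction w with
  | zero => exact le_rfl
  | succ w ih => exact (relFil_succ_le hlt hst (by omega) hw).trans (ih (by omega))

/-- The right-hand side `L` is normal, being generated by central elements modulo `relFil (w + 1)`,
so normal generators suffice. The starting tuple generates the same subgroup as `y w`. A commutator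
`[a, c]` with `p + q > w` already lies in `relFil (w + 1)`. If `p + q = w`, then `c` is expressed
through the basis `x q` modulo `lcs (q + 1)`: the commutators of `a` with the basis are entries of
the starting tuple up to inversion, and those with `lcs (q + 1)` lie in `relFil (w + 1)`. -/
theorem relFil_le_sup (hlt : IsCommutatorOrder lt)
    (hst : ∀ w, 1 ≤ w → w ≤ n → IsStage rel x y s lt d w) {w : ℕ} (hw : 1 ≤ w) (hwn : w ≤ n) :
    relFil rel x y s w ≤
      Subgroup.closure {g | g ∈ rBasic y s w} ⊔ relFil rel x y s (w + 1) := by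
  set L := Subgroup.closure {g | g ∈ rBasic y s w} ⊔ relFil rel x y s (w + 1) with hL
  have hKL : relFil rel x y s (w + 1) ≤ L := le_sup_right
  have hgens : ∀ g ∈ stageGens rel x y s w, g ∈ L := by
    intro g hg
    apply closure_le_closure_rBasic hw
    rw [(hst w hw hwn).nielsen_y.closure_eq]
    exact Subgroup.subset_closure hg
  have hLn : L.Normal := by
    apply normal_of_central_mod hKL
    intro l hl g
    refine (sup_le ?_ (le_centMod _ g) : L ≤ centMod (relFil rel x y s (w + 1)) g) hl
    rw [Subgroup.closure_le]
    exact fun a ha => rBasic_central hw ha g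
  refine Subgroup.normalClosure_le_normal ?_
  rintro g (hg | ⟨p, q, hp, hpw, hq, hpq, a, ha, c, hc, rfl⟩)
  · exact hgens g hg
  rcases hpq.eq_or_lt with hpq | hpq
  · rw [SetLike.mem_coe, gcomm_mem_iff']
    refine (((hst q hq (by omega)).isLcsBasis hlt hq).span.trans (sup_le ?_ ?_)) hc
    · rw [Subgroup.closure_le]
      intro b hb
      obtain ⟨v, rfl⟩ : ∃ v, w = v + 1 := ⟨w - 1, by omega⟩
      rcases gcomm_mem_crossComm ha hb with h | h
      · exact gcomm_mem_iff'.1 (hgens _ ((mem_stageGens_succ (by omega)).2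
          (Or.inr ⟨p, q, hp, hq, hpq.symm, h⟩)))
      · exact gcomm_mem_iff.1 (hgens _ ((mem_stageGens_succ (by omega)).2
          (Or.inr ⟨p, q, hp, hq, hpq.symm, h⟩)))
    · intro c' hc'
      exact gcomm_mem_iff'.1 (hKL (gcomm_mem_relFil hp (by omega) (by omega) (by omega) ha hc'))
  · exact hKL (gcomm_mem_relFil hp (by omega) hq hpq ha hc)

end Filtration

/-! ### Unique exponents for the `R`-basic commutators. -/

section Uniqueness

/-- A reordering of the `R`-basic commutators is lifted to one of the pairs (weight, index), so that
each factor keeps its weight and its diagonal entry. -/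
theorem exists_perm_map_eq {α β : Type*} (f : α → β) {l : List β} {L : List α}
    (h : l.Perm (L.map f)) : ∃ L' : List α, L'.Perm L ∧ L'.map f = l := by
  generalize hM : L.map f = M at h
  induction h generalizing L with
  | nil => exact ⟨L, List.Perm.refl _, hM⟩
  | cons a h ih =>
    obtain ⟨a', L₁, rfl, rfl, h1⟩ := List.map_eq_cons_iff.1 hM
    obtain ⟨L', hL', rfl⟩ := ih h1
    exact ⟨a' :: L', hL'.cons _, rfl⟩
  | swap a b l =>
    obtain ⟨a', L₁, rfl, rfl, h1⟩ := List.map_eq_cons_iff.1 hM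
    obtain ⟨b', L₂, rfl, rfl, rfl⟩ := List.map_eq_cons_iff.1 h1
    exact ⟨b' :: a' :: L₂, List.Perm.swap _ _ _, rfl⟩
  | trans _ _ ih1 ih2 =>
    obtain ⟨L₁, h1, rfl⟩ := ih2 hM
    obtain ⟨L₂, h2, rfl⟩ := ih1 rfl
    exact ⟨L₂, h2.trans h1, rfl⟩

/-- The pairs of a weight at most `n` and an index below `s` of that weight. -/
def weightIndices (s : ℕ → ℕ) (n : ℕ) : List (ℕ × ℕ) :=
  (List.range' 1 n).flatMap fun w => (List.range (s w)).map fun j => (w, j)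

theorem mem_weightIndices {s : ℕ → ℕ} {n : ℕ} {p : ℕ × ℕ} :
    p ∈ weightIndices s n ↔ (1 ≤ p.1 ∧ p.1 ≤ n) ∧ p.2 < s p.1 := by
  obtain ⟨w, j⟩ := p
  simp only [weightIndices, List.mem_flatMap, List.mem_range'_1, List.mem_map, List.mem_range,
    Prod.mk.injEq]
  constructor
  · rintro ⟨w, hw, j, hj, rfl, rfl⟩
    exact ⟨by omega, hj⟩
  · rintro ⟨hw, hj⟩
    exact ⟨w, by omega, j, hj, rfl, rfl⟩

theorem nodup_weightIndices (s : ℕ → ℕ) (n : ℕ) : (weightIndices s n).Nodup := by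
  rw [weightIndices, List.nodup_flatMap]
  refine ⟨fun w _ => List.nodup_range.map fun a b h => congrArg Prod.snd h, ?_⟩
  refine (List.nodup_range' (s := 1) (n := n)).imp ?_
  intro a b hab p hp hp'
  obtain ⟨_, _, rfl⟩ := List.mem_map.1 hp
  obtain ⟨_, _, h⟩ := List.mem_map.1 hp'
  exact hab (congrArg Prod.fst h).symm

theorem take_eq_map_range {α : Type*} (l : List α) (n : ℕ) (h : n ≤ l.length) (a : α) :
    l.take n = (List.range n).map fun j => l.getD j a := by
  apply List.ext_getElem
  · simp [h]
  · intro i h1 h2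
    have : i < l.length := by simp at h1; omega
    simp [List.getElem?_eq_getElem this]

variable {k : ℕ} {rel : List (FreeGroup (Fin k))} {x y : ℕ → List (FreeGroup (Fin k))}
  {s : ℕ → ℕ} {lt : FreeMagma (Fin k) → FreeMagma (Fin k) → Prop} {d : ℕ → ℕ → ℕ} {n : ℕ}

theorem rBasicsUpTo_eq (hst : ∀ w, 1 ≤ w → w ≤ n → IsStage rel x y s lt d w) :
    rBasicsUpTo y s n = (weightIndices s n).map fun p => (y p.1).getD p.2 1 := by
  rw [rBasicsUpTo, weightIndices, List.map_flatMap, List.flatMap_congr]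
  intro w hw
  rw [List.mem_range'_1] at hw
  rw [rBasic, take_eq_map_range _ _ (hst w hw.1 (by omega)).s_le_y 1, List.map_map]
  rfl

theorem IsStage.lead_eq {w : ℕ} (hlt : IsCommutatorOrder lt) (hw : 1 ≤ w)
    (h : IsStage rel x y s lt d w) {j : ℕ} (hj : j < s w) :
    lead w ((y w).getD j 1) = d w j • lead w ((x w).getD j 1) := by
  have hjx := hj.trans_le h.s_le_x
  have hjy := hj.trans_le h.s_le_y
  have h1 := h.diag j hjy hjx hj
  have hx : (x w)[j] ∈ lcs _ w := (h.isLcsBasis hlt hw).mem _ (List.getElem_mem _)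
  have hxd := pow_mem hx (d w j)
  have hy : (y w)[j] ∈ lcs _ w :=
    (Subgroup.mul_mem_cancel_left _ (inv_mem hxd)).1 (lcs_antitone (Nat.le_succ w) h1)
  have h2 := lead_eq_zero hw h1
  rw [lead_mul hw (inv_mem hxd) hy, lead_inv hw hxd, lead_pow hw hx, neg_add_eq_zero] at h2
  rw [List.getD_eq_getElem _ _ hjy, List.getD_eq_getElem _ _ hjx, h2]

/-- Each element of the normal closure of the relators has unique exponents with respect to the
`R`-basic commutators, in any order. -/
theorem existsUnique_exponents (hlt : IsCommutatorOrder lt)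
    (hst : ∀ w, 1 ≤ w → w ≤ n → IsStage rel x y s lt d w) {r : List (FreeGroup (Fin k))}
    (hr : r.Perm (rBasicsUpTo y s n)) {g : FreeGroup (Fin k)}
    (hg : g ∈ Subgroup.normalClosure {g : FreeGroup (Fin k) | g ∈ rel}) :
    ∃! α : Fin r.length → ℤ, g⁻¹ * (List.ofFn fun i => r.get i ^ α i).prod ∈
      Subgroup.normalClosure {g : FreeGroup (Fin k) | g ∈ rel} ⊓ lcs (FreeGroup (Fin k)) (n + 1) := by
  rw [rBasicsUpTo_eq hst] at hr
  obtain ⟨L, hL, rfl⟩ := exists_perm_map_eq _ hr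
  set f : ℕ × ℕ → FreeGroup (Fin k) := fun p => (y p.1).getD p.2 1 with hf
  have hnd : L.Nodup := hL.nodup_iff.2 (nodup_weightIndices s n)
  have hlen : ∀ i : Fin (L.map f).length, (i : ℕ) < L.length := fun i => by simpa using i.2
  let ix : Fin (L.map f).length → ℕ × ℕ := fun i => L[(i : ℕ)]'(hlen i)
  have hix : ∀ i, (1 ≤ (ix i).1 ∧ (ix i).1 ≤ n) ∧ (ix i).2 < s (ix i).1 := fun i =>
    mem_weightIndices.1 (hL.mem_iff.1 (List.getElem_mem _))
  have hinj : Function.Injective ix := fun i j hij =>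
    Fin.ext ((List.Nodup.getElem_inj_iff hnd).1 hij)
  have hsurj : ∀ w j, 1 ≤ w → w ≤ n → j < s w → ∃ i, ix i = (w, j) := by
    intro w j h1 h2 h3
    obtain ⟨i, hi, h⟩ := List.getElem_of_mem
      (hL.mem_iff.2 ((mem_weightIndices (p := (w, j))).2 ⟨⟨h1, h2⟩, h3⟩))
    exact ⟨⟨i, by simpa using hi⟩, h⟩
  have hfi : ∀ i : Fin (L.map f).length, (L.map f).get i = f (ix i) := fun i => by
    simp [ix]
  have hstix : ∀ i, IsStage rel x y s lt d (ix i).1 := fun i => hst _ (hix i).1.1 (hix i).1.2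
  have hmem : ∀ i, f (ix i) ∈ rBasic y s (ix i).1 := by
    intro i
    have h1 := (hix i).2
    have h2 := h1.trans_le (hstix i).s_le_y
    rw [rBasic, take_eq_map_range _ _ (hstix i).s_le_y 1]
    exact List.mem_map.2 ⟨_, List.mem_range.2 h1, rfl⟩
  have hlcs : ∀ i, f (ix i) ∈ lcs _ (ix i).1 := fun i =>
    mem_lcs_of_mem hlt hst (hix i).1.1 (hix i).1.2 (List.mem_of_mem_take (hmem i))
  simp only [hfi]
  have hind : ∀ w, 1 ≤ w → w ≤ n →
      LinearIndepOn ℤ (fun i => lead w (f (ix i))) {i | (ix i).1 = w} := by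
    intro w hw hwn
    have hx := ((hst w hw hwn).isLcsBasis hlt hw).indep
    have h1 : ∀ i : {i // (ix i).1 = w}, (ix i).2 < (x w).length := by
      rintro ⟨i, rfl⟩
      exact (hix i).2.trans_le (hstix i).s_le_x
    have h2 := hx.comp (fun i : {i // (ix i).1 = w} => (⟨(ix i).2, h1 i⟩ : Fin (x w).length))
      fun i j hij => Subtype.ext (hinj (Prod.ext (i.2.trans j.2.symm) (congrArg Fin.val hij)))
    rw [linearIndependent_iff'] at h2
    change LinearIndependent ℤ fun i : {i // (ix i).1 = w} => lead w (f (ix i))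
    rw [linearIndependent_iff']
    intro S c hc i hi
    -- A relation among the leads of the `y` entries is one among the leads of the `x` entries with
    -- coefficients multiplied by the diagonal entries, which are positive.
    have h3 := h2 S (fun i => c i * d w (ix i).2) (by
      rw [← hc]
      refine Finset.sum_congr rfl fun j _ => ?_
      have h4 := (hix j.1).2
      rw [j.2] at h4
      have h5 := (hst w hw hwn).lead_eq hlt hw h4
      change _ = c j • lead w ((y (ix j).1).getD (ix j).2 1)
      rw [j.2, h5, mul_smul, natCast_zsmul, List.getD_eq_getElem _ _ (h1 j)]
      rfl) i hi
    have h4 := (hst w hw hwn).d_pos (ix i).2 (by have := (hix i.1).2; rwa [i.2] at this)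
    rcases mul_eq_zero.1 h3 with h | h
    · exact h
    · omega
  rw [← relFil_one (x := x) (y := y) (s := s)] at hg ⊢
  obtain ⟨α, hα⟩ := exists_exponents (n := n) (fun i => f (ix i)) (fun i => (ix i).1)
    (relFil rel x y s)
    (fun w hw hwn => (relFil_le_sup hlt hst hw hwn).trans
      (sup_le_sup_right (Subgroup.closure_mono (by
        intro a ha
        obtain ⟨j, hj, rfl⟩ := List.getElem_of_mem ha
        have hj' : j < s w ∧ j < (y w).length := by simpa [rBasic] using hj
        obtain ⟨i, hi⟩ := hsurj w j hw hwn hj'.1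
        refine ⟨i, congrArg Prod.fst hi, ?_⟩
        simp [hi, hf, rBasic, hj'.2])) _))
    (fun i g => rBasic_central (hix i).1.1 (hmem i) g) hg
  -- Existence holds modulo `relFil (n + 1)`, which is contained in the intersection; uniqueness
  -- needs only `lcs (n + 1)`. Equality of the two subgroups is not required.
  refine ⟨α, ⟨relFil_le_one hlt hst le_rfl hα, relFil_le_lcs hlt hst (by omega) le_rfl hα⟩, ?_⟩
  intro β hβ
  refine exponents_unique (fun i => f (ix i)) (fun i => (ix i).1) hlcs (fun i => (hix i).1)
    hind ?_
  have := (lcs _ (n + 1)).mul_mem ((lcs _ (n + 1)).inv_mem hβ.2)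
    (relFil_le_lcs hlt hst (by omega) le_rfl hα)
  simpa [mul_assoc] using this

end Uniqueness

/-! ### Smith normal form by elementary operations. -/

section SmithForm

/-- Integer matrices. -/
abbrev IntMat (m n : ℕ) := Fin m → Fin n → ℤ

/-- The transpose of an integer matrix. -/
def tr {m n : ℕ} (M : IntMat m n) : IntMat n m := fun j i => M i j

theorem tr_tr {m n : ℕ} (M : IntMat m n) : tr (tr M) = M := rfl

theorem tr_apply {m n : ℕ} (M : IntMat m n) (i : Fin m) (j : Fin n) : tr M j i = M i j := rfl

/-- Elementary operations on the rows of an integer matrix. -/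
inductive RowOp {m n : ℕ} : IntMat m n → IntMat m n → Prop
  /-- exchange two rows -/
  | swap (M : IntMat m n) (i i' : Fin m) : RowOp M fun a => M (Equiv.swap i i' a)
  /-- negate a row -/
  | neg (M : IntMat m n) (i : Fin m) : RowOp M (Function.update M i (-M i))
  /-- add a row to another row -/
  | add (M : IntMat m n) (i i' : Fin m) (h : i ≠ i') :
      RowOp M (Function.update M i (M i + M i'))

/-- Elementary operations on the rows or on the columns of an integer matrix. -/
def ElemOp {m n : ℕ} (M M' : IntMat m n) : Prop :=
  RowOp M M' ∨ RowOp (tr M) (tr M')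

/-- Reachability by elementary operations. -/
def ElemReach {m n : ℕ} : IntMat m n → IntMat m n → Prop :=
  Relation.ReflTransGen ElemOp

variable {m n : ℕ} {M M' M'' : IntMat m n}

theorem RowOp.reach (h : RowOp M M') : ElemReach M M' := Relation.ReflTransGen.single (Or.inl h)

theorem ElemReach.trans (h : ElemReach M M') (h' : ElemReach M' M'') : ElemReach M M'' :=
  Relation.ReflTransGen.trans h h'

theorem ElemReach.transpose (h : ElemReach M M') : ElemReach (tr M) (tr M') := by
  induction h with
  | refl => exact Relation.ReflTransGen.refl
  | tail _ h ih => exact ih.tail (Or.symm h)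

theorem ElemReach.add_zsmul (M : IntMat m n) {i p : Fin m} (h : i ≠ p) (c : ℤ) :
    ElemReach M (Function.update M i (M i + c • M p)) := by
  have key : ∀ (M : IntMat m n) (c : ℕ),
      ElemReach M (Function.update M i (M i + (c : ℤ) • M p)) := by
    intro M c
    induction c with
    | zero =>
      rw [Nat.cast_zero, zero_smul, add_zero, Function.update_eq_self]
      exact Relation.ReflTransGen.refl
    | succ c ih =>
      refine ih.trans ?_
      have := (RowOp.add (Function.update M i (M i + (c : ℤ) • M p)) i p h).reach
      rw [Function.update_idem, Function.update_self, Function.update_of_ne h.symm] at this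
      rwa [Nat.cast_succ, add_smul, one_smul, ← add_assoc]
  obtain ⟨c, rfl | rfl⟩ := c.eq_nat_or_neg
  · exact key M c
  -- A negative multiple is added by negating row `p`, adding, and negating it back.
  · have h1 := (RowOp.neg M p).reach
    have h2 := key (Function.update M p (-M p)) c
    have h3 := (RowOp.neg (Function.update (Function.update M p (-M p)) i
      (Function.update M p (-M p) i + (c : ℤ) • Function.update M p (-M p) p)) p).reach
    have e : Function.update M i (M i + -(c : ℤ) • M p) = Function.update (Function.update
        (Function.update M p (-M p)) i (Function.update M p (-M p) i +
        (c : ℤ) • Function.update M p (-M p) p)) p (-Function.update (Function.update M p (-M p)) i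
        (Function.update M p (-M p) i + (c : ℤ) • Function.update M p (-M p) p) p) := by
      funext a
      by_cases hap : a = p
      · subst hap
        simp [h.symm]
      · by_cases hai : a = i
        · subst hai
          simp [h]
        · simp [hap, hai]
    rw [e]
    exact (h1.trans h2).trans h3

/-- Add multiples of the row `p` to all rows. -/
def addRows (M : IntMat m n) (p : Fin m) (q : Fin m → ℤ) :
    IntMat m n := fun i j => M i j + q i * M p j

theorem ElemReach.addRows (M : IntMat m n) {p : Fin m} {q : Fin m → ℤ}
    (hq : q p = 0) : ElemReach M (addRows M p q) := by
  classical
  suffices h : ∀ S : Finset (Fin m), p ∉ S →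
      ElemReach M (RelBasic.addRows M p fun i => if i ∈ S then q i else 0) by
    convert h (Finset.univ.erase p) (by simp) using 2
    ext i
    by_cases hi : i = p
    · simp [hi, hq]
    · simp [hi]
  intro S
  induction S using Finset.induction_on with
  | empty =>
    intro _
    have : (RelBasic.addRows M p fun i => if i ∈ (∅ : Finset (Fin m)) then q i else 0) = M := by
      ext i j; simp [RelBasic.addRows]
    rw [this]
    exact Relation.ReflTransGen.refl
  | insert a S ha ih =>
    intro hp
    rw [Finset.mem_insert, not_or] at hp
    refine (ih hp.2).trans ?_
    have := ElemReach.add_zsmul (RelBasic.addRows M p fun i => if i ∈ S then q i else 0)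
      (Ne.symm hp.1) (q a)
    convert this using 1
    funext i j
    by_cases hi : i = a
    · subst hi
      simp [RelBasic.addRows, ha, hp.2]
    · simp [RelBasic.addRows, hi]

/-- The first `s` rows and columns are in Smith normal form with diagonal entries `d`, and these
divide the remaining entries. -/
structure SmithUpTo (s : ℕ) (d : ℕ → ℕ) (M : IntMat m n) : Prop where
  le_rows : s ≤ m
  le_cols : s ≤ n
  eq : ∀ (i : Fin m) (j : Fin n), (i : ℕ) < s ∨ (j : ℕ) < s → M i j = if (i : ℕ) = j then (d i : ℤ) else 0
  pos : ∀ t, t < s → 0 < d t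
  dvd : ∀ t, t + 1 < s → d t ∣ d (t + 1)
  dvd_rest : ∀ t, t < s → ∀ (i : Fin m) (j : Fin n), s ≤ (i : ℕ) → s ≤ (j : ℕ) → (d t : ℤ) ∣ M i j

namespace SmithUpTo

variable {s : ℕ} {d : ℕ → ℕ}

theorem transpose (h : SmithUpTo s d M) : SmithUpTo s d (tr M) where
  le_rows := h.le_cols
  le_cols := h.le_rows
  eq i j hij := by
    rw [tr_apply, h.eq j i hij.symm]
    by_cases e : (i : ℕ) = j
    · simp [e]
    · simp [e, Ne.symm e]
  pos := h.pos
  dvd := h.dvd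
  dvd_rest t ht i j hi hj := h.dvd_rest t ht j i hj hi

theorem addRows (h : SmithUpTo s d M) {p : Fin m} (hp : s ≤ (p : ℕ)) {q : Fin m → ℤ}
    (hq : ∀ i : Fin m, (i : ℕ) < s → q i = 0) : SmithUpTo s d (addRows M p q) where
  le_rows := h.le_rows
  le_cols := h.le_cols
  eq i j hij := by
    rw [← h.eq i j hij, RelBasic.addRows, add_eq_left]
    by_cases hi : (i : ℕ) < s
    · rw [hq i hi, zero_mul]
    · have hj : (j : ℕ) < s := hij.resolve_left hi
      rw [h.eq p j (Or.inr hj), if_neg (by omega), mul_zero]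
  pos := h.pos
  dvd := h.dvd
  dvd_rest t ht i j hi hj :=
    dvd_add (h.dvd_rest t ht i j hi hj) (Dvd.dvd.mul_left (h.dvd_rest t ht p j hp hj) _)

theorem swap (h : SmithUpTo s d M) {i i' : Fin m} (hi : s ≤ (i : ℕ)) (hi' : s ≤ (i' : ℕ)) :
    SmithUpTo s d (fun a => M (Equiv.swap i i' a) : IntMat m n) where
  le_rows := h.le_rows
  le_cols := h.le_cols
  eq a j haj := by
    by_cases h1 : a = i
    · subst h1
      rw [Equiv.swap_apply_left, h.eq _ _ (by omega), if_neg (by omega), if_neg (by omega)]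
    · by_cases h2 : a = i'
      · subst h2
        rw [Equiv.swap_apply_right, h.eq _ _ (by omega), if_neg (by omega), if_neg (by omega)]
      · rw [Equiv.swap_apply_of_ne_of_ne h1 h2, h.eq a j haj]
  pos := h.pos
  dvd := h.dvd
  dvd_rest t ht a j ha hj := by
    refine h.dvd_rest t ht _ j ?_ hj
    rw [Equiv.swap_apply_def]
    split_ifs <;> assumption

theorem neg (h : SmithUpTo s d M) {i : Fin m} (hi : s ≤ (i : ℕ)) :
    SmithUpTo s d (Function.update M i (-M i)) where
  le_rows := h.le_rows
  le_cols := h.le_cols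
  eq a j haj := by
    by_cases h1 : a = i
    · subst h1
      rw [Function.update_self, Pi.neg_apply, h.eq _ _ haj, if_neg (by omega), neg_zero]
    · rw [Function.update_of_ne h1, h.eq a j haj]
  pos := h.pos
  dvd := h.dvd
  dvd_rest t ht a j ha hj := by
    by_cases h1 : a = i
    · subst h1
      rw [Function.update_self, Pi.neg_apply, dvd_neg]
      exact h.dvd_rest t ht _ j ha hj
    · rw [Function.update_of_ne h1]
      exact h.dvd_rest t ht _ j ha hj

/-- Elementary operations move a nonzero entry to the corner and make it positive. -/
theorem exists_corner (h : SmithUpTo s d M) {i : Fin m} {j : Fin n} (hi : s ≤ (i : ℕ))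
    (hj : s ≤ (j : ℕ)) (a : Fin m) (b : Fin n) (ha : (a : ℕ) = s) (hb : (b : ℕ) = s) :
    ∃ M', ElemReach M M' ∧ SmithUpTo s d M' ∧ M' a b = (M i j).natAbs := by
  have r1 := (RowOp.swap M a i).reach
  have h1 := h.swap (i := a) (i' := i) ha.ge hi
  set M1 : IntMat m n := fun c => M (Equiv.swap a i c) with hM1
  have r2 := (RowOp.swap (tr M1) b j).reach.transpose
  have h2 := (h1.transpose.swap (i := b) (i' := j) hb.ge hj).transpose
  set M2 : IntMat m n :=
    tr fun c => (tr M1) (Equiv.swap b j c) with hM2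
  have e2 : M2 a b = M i j := by simp [hM2, hM1, tr_apply]
  rw [tr_tr] at r2
  rcases Int.natAbs_eq (M i j) with e | e
  · exact ⟨M2, r1.trans r2, h2, by rw [e2, ← e]⟩
  · refine ⟨_, (r1.trans r2).trans (RowOp.neg M2 a).reach, h2.neg ha.ge, ?_⟩
    rw [Function.update_self, Pi.neg_apply, e2]
    omega

/-- If no entry of the remaining block reachable by elementary operations is smaller than the
corner `v`, then some reachable matrix has all other entries in the column of `v` equal to zero,
and the row of `v` is kept. -/
theorem exists_clear_column (h : SmithUpTo s d M) {v : ℕ} (a : Fin m) (b : Fin n)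
    (ha : (a : ℕ) = s) (hb : (b : ℕ) = s) (hv : M a b = v) (hv0 : 0 < v)
    (hmin : ∀ M', ElemReach M M' → SmithUpTo s d M' → ∀ (i : Fin m) (j : Fin n), s ≤ (i : ℕ) → s ≤ (j : ℕ) →
      M' i j ≠ 0 → v ≤ (M' i j).natAbs) :
    ∃ q : Fin m → ℤ, ElemReach M (RelBasic.addRows M a q) ∧
      SmithUpTo s d (RelBasic.addRows M a q) ∧ q a = 0 ∧ ∀ i, i ≠ a → RelBasic.addRows M a q i b = 0 := by
  have hb0 : ∀ i : Fin m, (i : ℕ) < s → M i b = 0 := fun i hi => by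
    rw [h.eq i b (Or.inl hi), if_neg (by omega)]
  -- Each entry of the column is replaced by its remainder modulo `v`, which minimality of `v`
  -- forces to be zero.
  let q : Fin m → ℤ := fun i => if i = a then 0 else -(M i b / v)
  have hq : ∀ i, M i b = 0 → q i = 0 := by
    intro i hi
    simp [q, hi]
  have r1 : ElemReach M (RelBasic.addRows M a q) := ElemReach.addRows M (by simp [q])
  have h1 : SmithUpTo s d (RelBasic.addRows M a q) := h.addRows ha.ge fun i hi => hq i (hb0 i hi)
  refine ⟨q, r1, h1, by simp [q], fun i hi => ?_⟩
  by_cases his : (i : ℕ) < s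
  · rw [RelBasic.addRows, hb0 i his, hq i (hb0 i his)]; simp
  have e : RelBasic.addRows M a q i b = M i b % v := by
    rw [RelBasic.addRows, hv, Int.emod_def]
    simp only [q, if_neg hi]
    ring
  by_contra hne
  have h2 := hmin _ r1 h1 i b (by omega) hb.ge hne
  rw [e] at h2
  have h3 := Int.emod_nonneg (M i b) (show (v : ℤ) ≠ 0 by omega)
  have h4 := Int.emod_lt_of_pos (M i b) (show (0 : ℤ) < v by omega)
  omega

/-- One more diagonal entry can be split off as long as the remaining block is not zero. -/
theorem exists_succ (h : SmithUpTo s d M) {i₀ : Fin m} {j₀ : Fin n} (hi₀ : s ≤ (i₀ : ℕ))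
    (hj₀ : s ≤ (j₀ : ℕ)) (h₀ : M i₀ j₀ ≠ 0) :
    ∃ M' d', ElemReach M M' ∧ SmithUpTo (s + 1) d' M' := by
  classical
  -- The corner is the smallest absolute value of a nonzero remaining entry over all reachable
  -- matrices of this shape, so no later operation can produce a smaller one.
  have hex : ∃ v, ∃ M', ElemReach M M' ∧ SmithUpTo s d M' ∧ ∃ (i : Fin m) (j : Fin n), s ≤ (i : ℕ) ∧ s ≤ (j : ℕ) ∧
      M' i j ≠ 0 ∧ (M' i j).natAbs = v :=
    ⟨_, M, Relation.ReflTransGen.refl, h, i₀, j₀, hi₀, hj₀, h₀, rfl⟩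
  obtain ⟨M1, r1, h1, i, j, hi, hj, hne, hv⟩ := Nat.find_spec hex
  have hmin0 : ∀ M', ElemReach M M' → SmithUpTo s d M' → ∀ (i : Fin m) (j : Fin n), s ≤ (i : ℕ) → s ≤ (j : ℕ) →
      M' i j ≠ 0 → Nat.find hex ≤ (M' i j).natAbs :=
    fun M' r h i j hi hj hne => Nat.find_min' hex ⟨M', r, h, i, j, hi, hj, hne, rfl⟩
  generalize Nat.find hex = v at hv hmin0
  have hv0 : 0 < v := by omega
  let a : Fin m := ⟨s, by omega⟩
  let b : Fin n := ⟨s, by omega⟩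
  obtain ⟨M2, r2, h2, e2⟩ := h1.exists_corner hi hj a b rfl rfl
  rw [hv] at e2
  have r2 := r1.trans r2
  obtain ⟨q, r3, h3, hqa, hcol⟩ := h2.exists_clear_column a b rfl rfl e2 hv0
    fun M' r => hmin0 M' (r2.trans r)
  have r3 := r2.trans r3
  set M3 := RelBasic.addRows M2 a q
  have e3 : M3 a b = v := by simp [M3, RelBasic.addRows, hqa, e2]
  obtain ⟨q', r4, h4, hqb, hrow⟩ := h3.transpose.exists_clear_column b a rfl rfl e3 hv0
    fun M' r h i j hi hj => hmin0 (tr M') (r3.trans r.transpose)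
      h.transpose j i hj hi
  set M4 := tr (RelBasic.addRows (tr M3) b q')
  have r4 : ElemReach M M4 := r3.trans r4.transpose
  have h4 : SmithUpTo s d M4 := h4.transpose
  have e4 : M4 a b = v := by
    simp [M4, tr_apply, RelBasic.addRows, hqb, e3]
  have hrow4 : ∀ j, j ≠ b → M4 a j = 0 := hrow
  have hcol4 : ∀ i, i ≠ a → M4 i b = 0 := by
    intro i hi
    have := hcol i hi
    simp [M4, tr_apply, RelBasic.addRows, hqb, this]
  have hdiv : ∀ (i : Fin m) (j : Fin n), s ≤ (i : ℕ) → s ≤ (j : ℕ) → (v : ℤ) ∣ M4 i j := by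
    intro i j hi hj
    by_cases hia : i = a
    · subst hia
      by_cases hjb : j = b
      · rw [hjb, e4]
      · rw [hrow4 j hjb]; exact dvd_zero _
    by_cases hjb : j = b
    · rw [hjb, hcol4 i hia]; exact dvd_zero _
    -- Adding row `i` to the corner row keeps the corner, since its column is clear, and copies `M4
    -- i j` into that row. Clearing the row once more shows that `v` divides this entry.
    have r5 := ElemReach.addRows M4 (p := i) (q := Pi.single a 1) (by simp [hia])
    have h5 := h4.addRows (p := i) hi (q := Pi.single a 1) fun c hc =>
      Pi.single_eq_of_ne (fun e => by subst e; exact lt_irrefl _ hc) _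
    set M5 := RelBasic.addRows M4 i (Pi.single a 1)
    have e5 : M5 a b = v := by simp [M5, RelBasic.addRows, e4, hcol4 i hia]
    have e5' : M5 a j = M4 i j := by simp [M5, RelBasic.addRows, hrow4 j hjb]
    have r5 := r4.trans r5
    obtain ⟨q'', -, -, -, hrow5⟩ := h5.transpose.exists_clear_column b a rfl rfl e5 hv0
      fun M' r h i j hi hj => hmin0 (tr M') (r5.trans r.transpose)
        h.transpose j i hj hi
    have := hrow5 j hjb
    rw [RelBasic.addRows, tr_apply, tr_apply, e5, e5'] at this
    exact ⟨-q'' j, by linarith⟩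
  refine ⟨M4, Function.update d s v, r4, by omega, by omega, ?_, ?_, ?_, ?_⟩
  · intro i j hij
    by_cases h' : (i : ℕ) < s ∨ (j : ℕ) < s
    · rw [h4.eq i j h']
      by_cases e : (i : ℕ) = j
      · rw [if_pos e, if_pos e, Function.update_of_ne (by omega)]
      · rw [if_neg e, if_neg e]
    · by_cases hia : i = a
      · subst hia
        by_cases hjb : j = b
        · subst hjb
          rw [e4, if_pos rfl]
          simp [a]
        · rw [hrow4 j hjb, if_neg fun e => hjb (Fin.ext e.symm)]
      · have hjb : j = b := by
          have : (i : ℕ) ≠ s := fun e => hia (Fin.ext e)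
          exact Fin.ext (show (j : ℕ) = s by omega)
        subst hjb
        rw [hcol4 i hia, if_neg fun e => hia (Fin.ext e)]
  · intro t ht
    by_cases e : t = s
    · simpa [e] using hv0
    · rw [Function.update_of_ne e]; exact h4.pos t (by omega)
  · intro t ht
    rw [Function.update_of_ne (show t ≠ s by omega)]
    by_cases e : t + 1 = s
    · rw [e, Function.update_self]
      have := h4.dvd_rest t (by omega) a b le_rfl le_rfl
      rw [e4] at this
      exact_mod_cast this
    · rw [Function.update_of_ne e]; exact h4.dvd t (by omega)
  · intro t ht i j hi hj
    by_cases e : t = s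
    · rw [e, Function.update_self]; exact hdiv i j (by omega) (by omega)
    · rw [Function.update_of_ne e]; exact h4.dvd_rest t (by omega) i j (by omega) (by omega)

end SmithUpTo

/-- Elementary operations bring an integer matrix into Smith normal form. -/
theorem exists_smith (M : IntMat m n) : ∃ M' s d, ElemReach M M' ∧
    SmithUpTo s d M' ∧ ∀ (i : Fin m) (j : Fin n), s ≤ (i : ℕ) → s ≤ (j : ℕ) → M' i j = 0 := by
  suffices h : ∀ (t s : ℕ) (d : ℕ → ℕ) (M : IntMat m n), m - s ≤ t →
      SmithUpTo s d M → ∃ M' s d, ElemReach M M' ∧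
      SmithUpTo s d M' ∧ ∀ (i : Fin m) (j : Fin n), s ≤ (i : ℕ) → s ≤ (j : ℕ) → M' i j = 0 by
    exact h m 0 (fun _ => 1) M (by omega) ⟨by omega, by omega, fun i j h => by omega,
      fun t h => by omega, fun t h => by omega, fun t h => by omega⟩
  intro t
  induction t with
  | zero =>
    intro s d M hs h
    exact ⟨M, s, d, Relation.ReflTransGen.refl, h, fun i j hi _ => by omega⟩
  | succ t ih =>
    intro s d M hs h
    by_cases h0 : ∀ (i : Fin m) (j : Fin n), s ≤ (i : ℕ) → s ≤ (j : ℕ) → M i j = 0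
    · exact ⟨M, s, d, Relation.ReflTransGen.refl, h, h0⟩
    push Not at h0
    obtain ⟨i, j, hi, hj, hne⟩ := h0
    obtain ⟨M', d', r, h'⟩ := h.exists_succ hi hj hne
    obtain ⟨M'', s'', d'', r', h''⟩ := ih (s + 1) d' M' (by omega) h'
    exact ⟨M'', s'', d'', r.trans r', h''⟩

end SmithForm

/-! ### Nielsen transformations of indexed tuples. -/

section NielsenTuples

theorem set_ofFn {G : Type*} {n : ℕ} (f : Fin n → G) (i : Fin n) (a : G) :
    (List.ofFn f).set i a = List.ofFn (Function.update f i a) := by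
  apply List.ext_getElem
  · simp
  · intro j h1 h2
    rw [List.getElem_set, List.getElem_ofFn, List.getElem_ofFn, Function.update_apply]
    by_cases h : (i : ℕ) = j
    · rw [if_pos h, if_pos (Fin.ext h.symm)]
    · rw [if_neg h, if_neg fun e => h (congrArg Fin.val e).symm]

variable {G : Type*} [Group G] {n : ℕ}

theorem nielsen_swap (f : Fin n → G) (i j : Fin n) :
    Nielsen (List.ofFn f) (List.ofFn fun a => f (Equiv.swap i j a)) := by
  have h := NielsenStep.swap (List.ofFn f) (i.cast (by simp)) (j.cast (by simp))
  have e : (List.ofFn fun a => f (Equiv.swap i j a)) =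
      List.ofFn (Function.update (Function.update f i (f j)) j (f i)) := by
    congr 1
    funext a
    by_cases hj : a = j
    · subst hj; simp
    · by_cases hi : a = i
      · subst hi; simp [hj]
      · simp [hi, hj, Equiv.swap_apply_of_ne_of_ne hi hj]
  rw [e, ← set_ofFn, ← set_ofFn]
  refine Relation.ReflTransGen.single ?_
  simpa using h

theorem nielsen_inv (f : Fin n → G) (i : Fin n) :
    Nielsen (List.ofFn f) (List.ofFn (Function.update f i (f i)⁻¹)) := by
  have h := NielsenStep.inv (List.ofFn f) (i.cast (by simp))
  rw [← set_ofFn]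
  refine Relation.ReflTransGen.single ?_
  simpa using h

theorem nielsen_mul (f : Fin n → G) {i j : Fin n} (hij : i ≠ j) :
    Nielsen (List.ofFn f) (List.ofFn (Function.update f i (f i * f j))) := by
  have h := NielsenStep.mul (List.ofFn f) (i.cast (by simp)) (j.cast (by simp))
    fun e => hij (by simpa [Fin.ext_iff] using e)
  rw [← set_ofFn]
  refine Relation.ReflTransGen.single ?_
  simpa using h

theorem Nielsen.trans {l l' l'' : List G} (h : Nielsen l l') (h' : Nielsen l' l'') :
    Nielsen l l'' :=
  Relation.ReflTransGen.trans h h'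

theorem nielsen_mul_inv (f : Fin n → G) {i j : Fin n} (hij : i ≠ j) :
    Nielsen (List.ofFn f) (List.ofFn (Function.update f i (f i * (f j)⁻¹))) := by
  have h1 := nielsen_inv f j
  have h2 := nielsen_mul (Function.update f j (f j)⁻¹) hij
  have h3 := nielsen_inv (Function.update (Function.update f j (f j)⁻¹) i
    (Function.update f j (f j)⁻¹ i * Function.update f j (f j)⁻¹ j)) j
  convert (h1.trans h2).trans h3 using 2
  funext a
  by_cases hj : a = j
  · subst hj; simp [hij.symm]
  · by_cases hi : a = i
    · subst hi; simp [hij]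
    · simp [hi, hj]

end NielsenTuples

/-! ### Diagonal form modulo the next term of the lower central series. -/

section Diagonalization

variable {k w m n : ℕ}

/-- `M` expresses the tuple `a` through the tuple `b`, modulo `lcs (w + 1)`. -/
structure Represents (w : ℕ) (M : IntMat m n) (a : Fin m → FreeGroup (Fin k))
    (b : Fin n → FreeGroup (Fin k)) : Prop where
  left_mem : ∀ i, a i ∈ lcs _ w
  right_mem : ∀ j, b j ∈ lcs _ w
  lead_eq : ∀ i, lead w (a i) = ∑ j, M i j • lead w (b j)

theorem Represents.rowOp (hw : 1 ≤ w) {M M' : IntMat m n} {a : Fin m → FreeGroup (Fin k)}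
    {b : Fin n → FreeGroup (Fin k)} (h : Represents w M a b) (hM : RowOp M M') :
    ∃ a', Nielsen (List.ofFn a) (List.ofFn a') ∧ Represents w M' a' b := by
  cases hM with
  | swap i i' =>
    exact ⟨_, nielsen_swap a i i', fun c => h.left_mem _, h.right_mem, fun c => h.lead_eq _⟩
  | neg i =>
    refine ⟨_, nielsen_inv a i, fun c => ?_, h.right_mem, fun c => ?_⟩
    · by_cases hc : c = i
      · subst hc; rw [Function.update_self]; exact inv_mem (h.left_mem _)
      · rw [Function.update_of_ne hc]; exact h.left_mem _
    · by_cases hc : c = i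
      · subst hc
        rw [Function.update_self, Function.update_self, lead_inv hw (h.left_mem _), h.lead_eq]
        simp
      · rw [Function.update_of_ne hc, Function.update_of_ne hc]; exact h.lead_eq _
  | add i i' hi =>
    refine ⟨_, nielsen_mul a hi, fun c => ?_, h.right_mem, fun c => ?_⟩
    · by_cases hc : c = i
      · subst hc; rw [Function.update_self]; exact mul_mem (h.left_mem _) (h.left_mem _)
      · rw [Function.update_of_ne hc]; exact h.left_mem _
    · by_cases hc : c = i
      · subst hc
        rw [Function.update_self, Function.update_self,
          lead_mul hw (h.left_mem _) (h.left_mem _), h.lead_eq, h.lead_eq,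
          ← Finset.sum_add_distrib]
        simp [add_smul]
      · rw [Function.update_of_ne hc, Function.update_of_ne hc]; exact h.lead_eq _

/-- Column operations act contragrediently on the basis: adding column `j'` to column `j` is
compensated by replacing `b j'` with `b j' * (b j)⁻¹`. -/
theorem Represents.colOp (hw : 1 ≤ w) {M M' : IntMat m n} {a : Fin m → FreeGroup (Fin k)}
    {b : Fin n → FreeGroup (Fin k)} (h : Represents w M a b) (hM : RowOp (tr M) (tr M')) :
    ∃ b', Nielsen (List.ofFn b) (List.ofFn b') ∧ Represents w M' a b' := by
  rw [← tr_tr M']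
  generalize tr M' = N at hM
  cases hM with
  | swap j j' =>
    refine ⟨_, nielsen_swap b j j', h.left_mem, fun c => h.right_mem _, fun i => ?_⟩
    rw [h.lead_eq, ← Equiv.sum_comp (Equiv.swap j j')]
    rfl
  | neg j =>
    refine ⟨_, nielsen_inv b j, h.left_mem, fun c => ?_, fun i => ?_⟩
    · by_cases hc : c = j
      · subst hc; rw [Function.update_self]; exact inv_mem (h.right_mem _)
      · rw [Function.update_of_ne hc]; exact h.right_mem _
    · rw [h.lead_eq]
      refine Finset.sum_congr rfl fun c _ => ?_
      by_cases hc : c = j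
      · subst hc
        simp [tr, lead_inv hw (h.right_mem _)]
      · simp [tr, hc]
  | add j j' hj =>
    refine ⟨_, nielsen_mul_inv b hj.symm, h.left_mem, fun c => ?_, fun i => ?_⟩
    · by_cases hc : c = j'
      · subst hc; rw [Function.update_self]
        exact mul_mem (h.right_mem _) (inv_mem (h.right_mem _))
      · rw [Function.update_of_ne hc]; exact h.right_mem _
    · have key : ∀ c, tr (Function.update (tr M) j (tr M j + tr M j')) i c •
          lead w (Function.update b j' (b j' * (b j)⁻¹) c) = M i c • lead w (b c) +
          ((if c = j then M i j' • lead w (b j) else 0) -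
            if c = j' then M i j' • lead w (b j) else 0) := by
        intro c
        by_cases hc : c = j
        · subst hc
          simp [tr, hj, add_smul]
        · by_cases hc' : c = j'
          · subst hc'
            rw [Function.update_self, lead_mul hw (h.right_mem _) (inv_mem (h.right_mem _)),
              lead_inv hw (h.right_mem _)]
            simp [tr, hc, sub_eq_add_neg]
          · simp [tr, hc, hc']
      rw [h.lead_eq, Finset.sum_congr rfl fun c _ => key c, Finset.sum_add_distrib,
        Finset.sum_sub_distrib]
      simp

theorem Represents.of_reach (hw : 1 ≤ w) {M M' : IntMat m n} {a : Fin m → FreeGroup (Fin k)}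
    {b : Fin n → FreeGroup (Fin k)} (h : Represents w M a b) (hM : ElemReach M M') :
    ∃ a' b', Nielsen (List.ofFn a) (List.ofFn a') ∧ Nielsen (List.ofFn b) (List.ofFn b') ∧
      Represents w M' a' b' := by
  induction hM with
  | refl => exact ⟨a, b, Relation.ReflTransGen.refl, Relation.ReflTransGen.refl, h⟩
  | tail _ hop ih =>
    obtain ⟨a', b', ha, hb, h'⟩ := ih
    rcases hop with hop | hop
    · obtain ⟨a'', ha', h''⟩ := h'.rowOp hw hop
      exact ⟨a'', b', ha.trans ha', hb, h''⟩
    · obtain ⟨b'', hb', h''⟩ := h'.colOp hw hop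
      exact ⟨a', b'', ha, hb.trans hb', h''⟩

/-- A tuple in `lcs w` and a basis of `lcs w` modulo `lcs (w + 1)` can be brought into diagonal
form by Nielsen transformations. -/
theorem exists_diagonal (hw : 1 ≤ w) {l B : List (FreeGroup (Fin k))}
    (hl : ∀ g ∈ l, g ∈ lcs _ w) (hB : IsLcsBasis w B) :
    ∃ (X Y : List (FreeGroup (Fin k))) (s : ℕ) (d : ℕ → ℕ), Nielsen B X ∧ Nielsen l Y ∧
      s ≤ X.length ∧ s ≤ Y.length ∧ (∀ j, j < s → 0 < d j) ∧
      (∀ j, j + 1 < s → d j ∣ d (j + 1)) ∧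
      (∀ (j : ℕ) (hy : j < Y.length) (hx : j < X.length), j < s →
        (X[j] ^ d j)⁻¹ * Y[j] ∈ lcs (FreeGroup (Fin k)) (w + 1)) ∧
      ∀ (j : ℕ) (hy : j < Y.length), s ≤ j → Y[j] ∈ lcs (FreeGroup (Fin k)) (w + 1) := by
  have hrep : ∀ i : Fin l.length, ∃ c : Fin B.length → ℤ,
      lead w l[i] = ∑ j : Fin B.length, c j • lead w (B.get j) := fun i =>
    let ⟨c, _, hc⟩ := hB.exists_prod hw (hl _ (List.getElem_mem i.2))
    ⟨c, hc⟩
  choose M hM using hrep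
  have h : Represents w M (fun i : Fin l.length => l[i]) (fun j : Fin B.length => B.get j) :=
    ⟨fun i => hl _ (List.getElem_mem _), fun j => hB.mem _ (List.getElem_mem _), hM⟩
  obtain ⟨M', s, d, hr, hS, h0⟩ := exists_smith M
  obtain ⟨a, b, ha, hb, h'⟩ := h.of_reach hw hr
  have el : (List.ofFn fun i : Fin l.length => l[i]) = l := List.ofFn_getElem
  have eB : (List.ofFn fun i : Fin B.length => B.get i) = B := List.ofFn_getElem
  rw [el] at ha
  rw [eB] at hb
  have hX : IsLcsBasis w (List.ofFn b) := hB.of_nielsen hw hb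
  refine ⟨List.ofFn b, List.ofFn a, s, d, hb, ha, by simpa using hS.le_cols,
    by simpa using hS.le_rows, hS.pos, hS.dvd, ?_, ?_⟩
  · intro j hy hx hj
    rw [List.getElem_ofFn, List.getElem_ofFn]
    rw [List.length_ofFn] at hy hx
    have hbj := h'.right_mem ⟨j, hx⟩
    have haj := h'.left_mem ⟨j, hy⟩
    refine hX.mem_of_lead_eq_zero hw (mul_mem (inv_mem (pow_mem hbj _)) haj) ?_
    rw [lead_mul hw (inv_mem (pow_mem hbj _)) haj, lead_inv hw (pow_mem hbj _),
      lead_pow hw hbj, h'.lead_eq, Finset.sum_eq_single ⟨j, hx⟩, hS.eq _ _ (Or.inl hj), if_pos rfl]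
    · simp
    · intro c _ hc
      rw [hS.eq _ _ (Or.inl hj), if_neg fun e => hc (Fin.ext e.symm), zero_smul]
    · simp
  · intro j hy hj
    rw [List.getElem_ofFn]
    rw [List.length_ofFn] at hy
    refine hX.mem_of_lead_eq_zero hw (h'.left_mem _) ?_
    rw [h'.lead_eq]
    refine Finset.sum_eq_zero fun c _ => ?_
    by_cases hc : (c : ℕ) < s
    · rw [hS.eq _ _ (Or.inr hc), if_neg (by simp; omega), zero_smul]
    · rw [h0 _ _ hj (by omega), zero_smul]

end Diagonalization

/-! ### Carrying out the construction in all weights. -/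

section Existence

/-- Dependent choice: since `P w` sees only the values up to `w`, successive extensions never
disturb earlier conditions, and the diagonal sequence satisfies all of them. -/
theorem exists_seq_of_extension {T : Type*} [Inhabited T] (P : ℕ → (ℕ → T) → Prop)
    (hcongr : ∀ w t t', (∀ v ≤ w, t v = t' v) → P w t → P w t')
    (hstep : ∀ w t, (∀ v < w, P v t) → ∃ a, P w (Function.update t w a)) : ∃ t, ∀ w, P w t := by
  have hext : ∀ w, ∀ t : {t : ℕ → T // ∀ v < w, P v t}, ∃ t' : {t : ℕ → T // ∀ v < w + 1, P v t},
      ∀ v < w, t'.1 v = t.1 v := by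
    rintro w ⟨t, ht⟩
    obtain ⟨a, ha⟩ := hstep w t ht
    refine ⟨⟨Function.update t w a, fun v hv => ?_⟩, fun v hv => Function.update_of_ne hv.ne _ _⟩
    rcases (Nat.le_of_lt_succ hv).eq_or_lt with rfl | hv
    · exact ha
    · exact hcongr v t _ (fun u hu => (Function.update_of_ne (by omega) _ _).symm) (ht v hv)
  choose next hnext using hext
  let S : ∀ w, {t : ℕ → T // ∀ v < w, P v t} := fun w =>
    Nat.rec ⟨fun _ => default, fun v hv => absurd hv (Nat.not_lt_zero v)⟩ next w
  have hS : ∀ v w, v < w → (S w).1 v = (S (v + 1)).1 v := by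
    intro v w hvw
    induction w, hvw using Nat.le_induction with
    | base => rfl
    | succ w hw ih => rw [← ih]; exact hnext w (S w) v hw
  refine ⟨fun w => (S (w + 1)).1 w, fun w => ?_⟩
  exact hcongr w (S (w + 1)).1 _ (fun v hv => hS v (w + 1) (by omega))
    ((S (w + 1)).2 w (Nat.lt_succ_self w))

variable {k : ℕ} {rel : List (FreeGroup (Fin k))} {x y x' y' : ℕ → List (FreeGroup (Fin k))}
  {s s' : ℕ → ℕ} {lt : FreeMagma (Fin k) → FreeMagma (Fin k) → Prop} {d d' : ℕ → ℕ → ℕ} {w : ℕ}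

theorem stageGens_congr (hx : ∀ v < w, x v = x' v) (hy : ∀ v < w, y v = y' v)
    (hs : ∀ v < w, s v = s' v) : stageGens rel x y s w = stageGens rel x' y' s' w := by
  match w with
  | 0 => rfl
  | 1 => rfl
  | n + 2 =>
    rw [stageGens, stageGens, hy _ (by omega), hs _ (by omega)]
    congr 1
    refine List.flatMap_congr fun pq hpq => ?_
    rw [List.Nat.mem_antidiagonal] at hpq
    rw [crossComm, crossComm, rBasic, rBasic, hy _ (by omega), hs _ (by omega), hx _ (by omega)]

theorem IsStage.congr (h : IsStage rel x y s lt d w) (hx : ∀ v ≤ w, x v = x' v)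
    (hy : ∀ v ≤ w, y v = y' v) (hs : ∀ v ≤ w, s v = s' v) (hd : d w = d' w) :
    IsStage rel x' y' s' lt d' w := by
  have hg : stageGens rel x y s w = stageGens rel x' y' s' w :=
    stageGens_congr (fun v hv => hx v hv.le) (fun v hv => hy v hv.le) fun v hv => hs v hv.le
  obtain ⟨h1, h2, h3, h4, h5, h6, h7, h8⟩ := h
  rw [hx w le_rfl] at h1 h3
  rw [hg, hy w le_rfl] at h2
  rw [hs w le_rfl] at h3 h4 h5 h6
  rw [hy w le_rfl] at h4
  rw [hd] at h5 h6
  simp only [hx w le_rfl, hy w le_rfl, hs w le_rfl, hd] at h7 h8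
  exact ⟨h1, h2, h3, h4, h5, h6, h7, h8⟩

/-- The construction can be carried out in all weights. -/
theorem exists_stages (hlt : IsCommutatorOrder lt) (rel : List (FreeGroup (Fin k))) :
    ∃ (x y : ℕ → List (FreeGroup (Fin k))) (s : ℕ → ℕ) (d : ℕ → ℕ → ℕ),
      ∀ w, 1 ≤ w → IsStage rel x y s lt d w := by
  let P : ℕ → (ℕ → List (FreeGroup (Fin k)) × List (FreeGroup (Fin k)) × ℕ × (ℕ → ℕ)) → Prop :=
    fun w t => 1 ≤ w → IsStage rel (fun v => (t v).1) (fun v => (t v).2.1) (fun v => (t v).2.2.1) lt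
      (fun v => (t v).2.2.2) w
  obtain ⟨t, ht⟩ := exists_seq_of_extension P
    (fun w t t' htt h hw => (h hw).congr (fun v hv => by rw [htt v hv])
      (fun v hv => by rw [htt v hv]) (fun v hv => by rw [htt v hv]) (by rw [htt w le_rfl])) (by
    intro w t ht
    by_cases hw : 1 ≤ w
    swap
    · exact ⟨default, fun h => absurd h hw⟩
    obtain ⟨B, hB⟩ := exists_isBasicList lt w
    obtain ⟨v, rfl⟩ := Nat.exists_eq_add_of_le' hw
    obtain ⟨X, Y, s, d, hX, hY, h1, h2, h3, h4, h5, h6⟩ := exists_diagonal hw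
      (stageGens_mem_lcs (n := v) hlt (fun u hu huv => ht u (by omega) hu) hw le_rfl)
      (hB.isLcsBasis hlt hw)
    refine ⟨(X, Y, s, d), fun _ => ?_⟩
    -- The starting tuple of weight `v + 1` uses only smaller weights, so it is unaffected by the
    -- value now assigned at `v + 1`.
    rw [stageGens_congr
      (x' := fun u => (Function.update t (v + 1) (X, Y, s, d) u).1)
      (y' := fun u => (Function.update t (v + 1) (X, Y, s, d) u).2.1)
      (s' := fun u => (Function.update t (v + 1) (X, Y, s, d) u).2.2.1)
      (fun u hu => by rw [Function.update_of_ne hu.ne])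
      (fun u hu => by rw [Function.update_of_ne hu.ne])
      (fun u hu => by rw [Function.update_of_ne hu.ne])] at hY
    constructor
    · exact ⟨B, hB, by simpa using hX⟩
    · simpa using hY
    · simpa using h1
    · simpa using h2
    · simpa using h3
    · simpa using h4
    · simpa using h5
    · simpa using h6)
  exact ⟨_, _, _, _, ht⟩

end Existence

end RelBasic

theorem mainTheorem1 (k : ℕ) (rel : List (FreeGroup (Fin k)))
    (lt : FreeMagma (Fin k) → FreeMagma (Fin k) → Prop)
    (hlt : RelBasic.IsCommutatorOrder lt) :
    -- the construction can be carried out in all weights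
    (∃ (x y : ℕ → List (FreeGroup (Fin k))) (s : ℕ → ℕ) (d : ℕ → ℕ → ℕ),
      ∀ w, 1 ≤ w → RelBasic.IsStage rel x y s lt d w) ∧
    -- however it is carried out up to weight `n`, and however the resulting `R`-basic commutators
    -- are ordered, each `w ∈ R` is a unique ordered product of their powers
    (∀ (n : ℕ) (x y : ℕ → List (FreeGroup (Fin k))) (s : ℕ → ℕ) (d : ℕ → ℕ → ℕ),
      (∀ w, 1 ≤ w → w ≤ n → RelBasic.IsStage rel x y s lt d w) →
      ∀ r : List (FreeGroup (Fin k)), r.Perm (RelBasic.rBasicsUpTo y s n) →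
      ∀ w ∈ Subgroup.normalClosure {g : FreeGroup (Fin k) | g ∈ rel},
        ∃! α : Fin r.length → ℤ,
          w⁻¹ * (List.ofFn fun i => r[i] ^ α i).prod ∈
            Subgroup.normalClosure {g : FreeGroup (Fin k) | g ∈ rel} ⊓
              RelBasic.lcs (FreeGroup (Fin k)) (n + 1)) := by
  refine ⟨RelBasic.exists_stages hlt rel, ?_⟩
  intro n x y s d hst r hr w hw
  exact RelBasic.existsUnique_exponents hlt hst hr hw
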